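/- Notation. For distinct $\sigma,\tau\in\{0,1\}^{\mathbb N}$ let $\sigma\wedge\tau$ be their longest common initial segment and $|\sigma\wedge\tau|\in\{0,1,2,\dots\}$ its length; $s\sqsubsetneq t$ means that $s$ is a proper initial segment of $t$. For $n\ge 1$ define recursively sets $\mathscr G_n$ of pairs $(F,\sigma)$, with $F\subset\{0,1\}^{\mathbb N}$ finite and $\sigma\in\{0,1\}^{\mathbb N}$, and numbers $\operatorname{vmin}(F,\sigma)$, $\operatorname{vmax}(F,\sigma)$, as follows (throughout $d\ge 1$). $\bullet$ $(F,\sigma)\in\mathscr G_1$ iff $F=\{\tau_1,\dots,\tau_d\}$ with $\sigma\ne\tau_i$ for all $i$, $\varnothing\neq\sigma\wedge\tau_1\sqsubsetneq\dots\sqsubsetneq\sigma\wedge\tau_d$ and $d\le|\sigma\wedge\tau_1|$; then $\operatorname{vmin}(F,\sigma)=|\sigma\wedge\tau_1|$ and $\operatorname{vmax}(F,\sigma)=|\sigma\wedge\tau_d|$. $\bullet$ $(F,\sigma)\in\mathscr G_{n+1}$ iff one of the following holds: (a) $(F,\sigma)\in\mathscr G_n$ (with the same $\operatorname{vmin}$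 and $\operatorname{vmax}$); (b) $F=\bigcup_{i=1}^dF_i$ with $F_1,\dots,F_d$ pairwise disjoint, $(F_i,\sigma_i)\in\mathscr G_n$, $\sigma\ne\sigma_i$, $|\sigma\wedge\sigma_i|<\operatorname{vmin}(F_i,\sigma_i)$ for all $i$, $\varnothing\ne\sigma\wedge\sigma_1\sqsubsetneq\dots\sqsubsetneq\sigma\wedge\sigma_d$ and $d\le|\sigma\wedge\sigma_1|$, in which case $\operatorname{vmin}(F,\sigma)=|\sigma\wedge\sigma_1|$ and $\operatorname{vmax}(F,\sigma)=|\sigma\wedge\sigma_d|$; (c) $F=\bigcup_{i=1}^dF_i$ with $F_1,\dots,F_d$ pairwise disjoint, $(F_i,\sigma)\in\mathscr G_n$ for all $i$, $\operatorname{vmax}(F_i,\sigma)<\operatorname{vmin}(F_{i+1},\sigma)$ for $i<d$ and $d\le\operatorname{vmin}(F_1,\sigma)$, in which case $\operatorname{vmin}(F,\sigma)=\operatorname{vmin}(F_1,\sigma)$ and $\operatorname{vmax}(F,\sigma)=\operatorname{vmax}(F_d,\sigma)$. Let $\mathcal G_n=\{\varnothing\}\cup\{F:(F,\sigma)\in\mathscr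 G_n\text{ for some }\sigma\}$. Fix any bijection $\tau\mapsto\xi_\tau$ of $\{0,1\}^{\mathbb N}$ onto the set of ordinals below $\mathfrak c=2^{\aleph_0}$ (as an initial ordinal), and let $X_n$ be the real Banach space which is the completion of $c_{00}(\mathfrak c)$ under the norm $\|x\|_n=\sup\{|\sum_{\tau\in F}x_{\xi_\tau}|:F\in\mathcal G_n\}$. Let $(e_\xi)_{\xi<\mathfrak c}$ be the unit vectors. A sequence $(x_k)$ generates as a spreading model a seminorm $p$ on $c_{00}(\mathbb N)$ if for all scalars $a_1,\dots,a_k$ one has $\|\sum_{i\le k}a_ix_{m_i}\|\to p(\sum_{i\le k}a_ie_i)$ as $m_1<\dots<m_k$ and $m_1\to\infty$; it admits $p$ as a spreading model if some subsequence generates $p$. Proposition. For every $n\ge1$ the following hold. (i) $X_n$ is $c_0$-saturated: every infinite dimensional closed subspace of $X_n$ contains a subspace isomorphic to $c_0$. (ii) $(e_\xi)_{\xi<\mathfrak c}$ is a (transfinite) Schauder basis of $X_n$ of length $\mathfrak c$, i.e. every $x\in X_n$ has a unique representation as a convergent transfinite series $x=\sum_{\xi<\mathfrak c}a_\xi e_\xi$,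 and it is an unconditional basis of $X_n$. It is normalized ($\|e_\xi\|_n=1$), suppression unconditional ($\|\sum_{\xi\in G}a_\xi e_\xi\|_n\le\|\sum_{\xi\in F}a_\xi e_\xi\|_n$ for all finite $G\subset F\subset\mathfrak c$ and real scalars $a_\xi$) and weakly null (for every bounded linear functional $f$ and $\varepsilon>0$, $|f(e_\xi)|<\varepsilon$ for all but finitely many $\xi$). (iii) For every sequence $(\xi_k)_{k\in\mathbb N}$ of pairwise distinct ordinals below $\mathfrak c$, in particular for every subsequence $(e_{\xi_k})_k$ of the basis, the sequence $(e_{\xi_k})_k$ admits a spreading model, and every spreading model $p$ that it admits is equivalent to the usual basis of $\ell_1$: there are $c,C>0$ with $c\sum_i|a_i|\le p(\sum_ia_ie_i)\le C\sum_i|a_i|$ for all finitely supported $(a_i)$. -/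

import Mathlib

open Filter Topology

noncomputable section

/-- The Cantor set `{0,1}^ℕ` (coordinates are numbered from `0`). -/
abbrev CantorSet : Type := ℕ → Bool

/-- `|σ ∧ τ|`, the length of the longest common initial segment of `σ` and `τ`. It is only used
for `σ ≠ τ`. Both `σ ∧ τ` and `σ ∧ τ'` are initial segments of `σ`, so `σ ∧ τ` is a proper initial
segment of `σ ∧ τ'` exactly when `|σ ∧ τ| < |σ ∧ τ'|`. -/
def meetLen (σ τ : CantorSet) : ℕ := PiNat.firstDiff σ τ

/-- `GPair n F σ p q` says that the pair `(F, σ)` belongs to the `n`-th recursively defined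
collection of pairs, with `vmin (F, σ) = p` and `vmax (F, σ) = q`. The collections are indexed by
`n ≥ 1`. Finite sequences of length `d ≥ 1` are indexed by `Fin (m + 1)`, with `d = m + 1`. -/
inductive GPair : ℕ → Finset CantorSet → CantorSet → ℕ → ℕ → Prop
  /-- The first collection. -/
  | base (m : ℕ) (τ : Fin (m + 1) → CantorSet) (F : Finset CantorSet) (σ : CantorSet)
      (hF : (F : Set CantorSet) = Set.range τ)
      (hne : ∀ i, σ ≠ τ i)
      (hpos : meetLen σ (τ 0) ≠ 0)
      (hmono : StrictMono fun i => meetLen σ (τ i))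
      (hcard : m + 1 ≤ meetLen σ (τ 0)) :
      GPair 1 F σ (meetLen σ (τ 0)) (meetLen σ (τ (Fin.last m)))
  /-- Every collection is contained in the next one. -/
  | lift (n : ℕ) (F : Finset CantorSet) (σ : CantorSet) (p q : ℕ) (h : GPair n F σ p q) :
      GPair (n + 1) F σ p q
  /-- Unions of skipped branchings of `σ`. -/
  | skipped (n m : ℕ) (G : Fin (m + 1) → Finset CantorSet) (s : Fin (m + 1) → CantorSet)
      (p q : Fin (m + 1) → ℕ) (F : Finset CantorSet) (σ : CantorSet)
      (hG : ∀ i, GPair n (G i) (s i) (p i) (q i))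
      (hF : (F : Set CantorSet) = ⋃ i, (G i : Set CantorSet))
      (hdisj : ∀ i j, i ≠ j → Disjoint (G i) (G j))
      (hne : ∀ i, σ ≠ s i)
      (hpos : meetLen σ (s 0) ≠ 0)
      (hmono : StrictMono fun i => meetLen σ (s i))
      (hmin : ∀ i, meetLen σ (s i) < p i)
      (hcard : m + 1 ≤ meetLen σ (s 0)) :
      GPair (n + 1) F σ (meetLen σ (s 0)) (meetLen σ (s (Fin.last m)))
  /-- Unions of attached branchings of `σ`. -/
  | attached (n m : ℕ) (G : Fin (m + 1) → Finset CantorSet) (p q : Fin (m + 1) → ℕ)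
      (F : Finset CantorSet) (σ : CantorSet)
      (hG : ∀ i, GPair n (G i) σ (p i) (q i))
      (hF : (F : Set CantorSet) = ⋃ i, (G i : Set CantorSet))
      (hdisj : ∀ i j, i ≠ j → Disjoint (G i) (G j))
      (hlt : ∀ i : Fin m, q i.castSucc < p i.succ)
      (hcard : m + 1 ≤ p 0) :
      GPair (n + 1) F σ (p 0) (q (Fin.last m))

/-- The family `𝒢_n` of finite subsets of the Cantor set. -/
def GFam (n : ℕ) : Set (Finset CantorSet) :=
  {F | F = ∅ ∨ ∃ σ p q, GPair n F σ p q}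

theorem GFam.empty_mem (n : ℕ) : ∅ ∈ GFam n := Or.inl rfl

instance (n : ℕ) : Nonempty (GFam n) := ⟨⟨∅, GFam.empty_mem n⟩⟩

theorem GFam.singleton_mem (n : ℕ) [NeZero n] (τ : CantorSet) : {τ} ∈ GFam n := by
  obtain ⟨k, rfl⟩ := Nat.exists_eq_succ_of_ne_zero (NeZero.ne n)
  set σ : CantorSet := Function.update τ 1 (!τ 1) with hσ
  have hne : σ ≠ τ := fun h => by
    have := congrFun h 1
    simp [hσ] at this
  have hlen : meetLen σ τ = 1 := by
    have h1 : σ (PiNat.firstDiff σ τ) ≠ τ (PiNat.firstDiff σ τ) := PiNat.apply_firstDiff_ne hne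
    by_contra hc
    apply h1
    simp only [hσ]
    rw [Function.update_of_ne]
    exact hc
  have key : ∀ k : ℕ, GPair (k + 1) {τ} σ 1 1 := by
    intro k
    induction k with
    | zero =>
      have := GPair.base 0 (fun _ => τ) {τ} σ (by simp) (fun _ => hne) (by simp [hlen])
        (fun i j h => absurd h (by omega)) (by simp [hlen])
      simpa [hlen] using this
    | succ k ih => exact GPair.lift _ _ _ _ _ ih
  exact Or.inr ⟨σ, 1, 1, key k⟩

/-- The ordinals `ξ < 𝔠`, where `𝔠` is the cardinal of the continuum, as an initial ordinal. -/
abbrev ContIndex : Type 1 := Set.Iio (Cardinal.continuum.{0}).ord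

/-- The space `c₀₀(𝔠)`, to be equipped with the norm `‖·‖_n`; `ξ` is the chosen bijection of the
Cantor set with `𝔠`. -/
def C00 (_n : ℕ) (_ξ : CantorSet ≃ ContIndex) : Type 1 := ContIndex →₀ ℝ

instance (n : ℕ) (ξ : CantorSet ≃ ContIndex) : AddCommGroup (C00 n ξ) :=
  inferInstanceAs (AddCommGroup (ContIndex →₀ ℝ))

instance (n : ℕ) (ξ : CantorSet ≃ ContIndex) : Module ℝ (C00 n ξ) :=
  inferInstanceAs (Module ℝ (ContIndex →₀ ℝ))

/-- A finite set `F ⊆ {0,1}^ℕ` as a linear functional on `c₀₀(𝔠)`: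
`F(x) = ∑_{τ ∈ F} x (ξ τ)`. -/
def evalSet (n : ℕ) (ξ : CantorSet ≃ ContIndex) (F : Finset CantorSet) : C00 n ξ →ₗ[ℝ] ℝ :=
  ∑ τ ∈ F, (Finsupp.lapply (ξ τ) : (ContIndex →₀ ℝ) →ₗ[ℝ] ℝ)

theorem evalSet_apply (n : ℕ) (ξ : CantorSet ≃ ContIndex) (F : Finset CantorSet)
    (x : ContIndex →₀ ℝ) : evalSet n ξ F x = ∑ τ ∈ F, x (ξ τ) := by
  unfold evalSet
  exact (LinearMap.sum_apply (M := ContIndex →₀ ℝ) F _ x)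

/-- `‖x‖_n = sup {|F(x)| : F ∈ 𝒢_n}`. -/
def supNorm (n : ℕ) (ξ : CantorSet ≃ ContIndex) (x : C00 n ξ) : ℝ :=
  ⨆ F : GFam n, |evalSet n ξ F.1 x|

theorem supNorm_bddAbove (n : ℕ) (ξ : CantorSet ≃ ContIndex) (x : C00 n ξ) :
    BddAbove (Set.range fun F : GFam n => |evalSet n ξ F.1 x|) := by
  classical
  let y : ContIndex →₀ ℝ := x
  refine ⟨∑ η ∈ y.support, |y η|, ?_⟩
  rintro _ ⟨F, rfl⟩
  have h0 : evalSet n ξ F.1 x = ∑ τ ∈ F.1, y (ξ τ) := evalSet_apply n ξ F.1 y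
  change |evalSet n ξ F.1 x| ≤ _
  rw [h0]
  calc |∑ τ ∈ F.1, y (ξ τ)| ≤ ∑ τ ∈ F.1, |y (ξ τ)| := Finset.abs_sum_le_sum_abs _ _
    _ = ∑ η ∈ F.1.map ξ.toEmbedding, |y η| := by simp
    _ = ∑ η ∈ (F.1.map ξ.toEmbedding).filter (· ∈ y.support), |y η| := by
        rw [Finset.sum_filter_of_ne]
        intro η _ h
        simpa using h
    _ ≤ ∑ η ∈ y.support, |y η| := by
        refine Finset.sum_le_sum_of_subset_of_nonneg ?_ fun _ _ _ => abs_nonneg _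
        intro η h
        exact (Finset.mem_filter.1 h).2

theorem abs_evalSet_le (n : ℕ) (ξ : CantorSet ≃ ContIndex) (x : C00 n ξ) {F : Finset CantorSet}
    (hF : F ∈ GFam n) : |evalSet n ξ F x| ≤ supNorm n ξ x :=
  le_ciSup (supNorm_bddAbove n ξ x) (⟨F, hF⟩ : GFam n)

/-- For `n ≥ 1`, `‖·‖_n` is a norm on `c₀₀(𝔠)`. -/
instance (n : ℕ) [NeZero n] (ξ : CantorSet ≃ ContIndex) : NormedAddCommGroup (C00 n ξ) :=
  AddGroupNorm.toNormedAddCommGroup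
    { toFun := supNorm n ξ
      map_zero' := by simp [supNorm]
      add_le' := fun x y => by
        refine ciSup_le fun F => ?_
        rw [map_add]
        exact (abs_add_le _ _).trans
          (add_le_add (abs_evalSet_le n ξ x F.2) (abs_evalSet_le n ξ y F.2))
      neg' := fun x => by simp [supNorm]
      eq_zero_of_map_eq_zero' := fun x hx => by
        have key : ∀ η : ContIndex, (show ContIndex →₀ ℝ from x) η = 0 := fun η => by
          have h1 := abs_evalSet_le n ξ x (GFam.singleton_mem n (ξ.symm η))
          have h2 : evalSet n ξ {ξ.symm η} x = (show ContIndex →₀ ℝ from x) η := by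
            refine (evalSet_apply n ξ _ x).trans ?_
            simp
          rw [hx, h2] at h1
          exact abs_nonpos_iff.1 h1
        exact Finsupp.ext key }

instance (n : ℕ) [NeZero n] (ξ : CantorSet ≃ ContIndex) : NormedSpace ℝ (C00 n ξ) where
  norm_smul_le c x := by
    change supNorm n ξ (c • x) ≤ ‖c‖ * supNorm n ξ x
    refine ciSup_le fun F => ?_
    rw [map_smul, smul_eq_mul, abs_mul, Real.norm_eq_abs]
    exact mul_le_mul_of_nonneg_left (abs_evalSet_le n ξ x F.2) (abs_nonneg c)

/-- The Banach space `X_n`, the completion of `(c₀₀(𝔠), ‖·‖_n)`. -/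
abbrev XSpace (n : ℕ) [NeZero n] (ξ : CantorSet ≃ ContIndex) : Type 1 :=
  UniformSpace.Completion (C00 n ξ)

/-- The unit vector basis `(e_η)_{η < 𝔠}` of `X_n`. -/
def unitVec (n : ℕ) [NeZero n] (ξ : CantorSet ≃ ContIndex) (η : ContIndex) : XSpace n ξ :=
  ((show C00 n ξ from Finsupp.single η (1 : ℝ)) : UniformSpace.Completion (C00 n ξ))

section General

variable {E : Type*} [NormedAddCommGroup E] [NormedSpace ℝ E]

/-- `E` is `c₀`-saturated: every infinite dimensional closed subspace of `E` has a subspace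
isomorphic to `c₀`. -/
def IsC0Saturated (E : Type*) [NormedAddCommGroup E] [NormedSpace ℝ E] : Prop :=
  ∀ Y : Submodule ℝ E, IsClosed (Y : Set E) → ¬ FiniteDimensional ℝ Y →
    ∃ Z : Submodule ℝ E, Z ≤ Y ∧ Nonempty (ZeroAtInftyContinuousMap ℕ ℝ ≃L[ℝ] Z)

/-- The transfinite series `∑_{η < 𝔠} v η` converges to `x`: there are partial sums
`s η = ∑_{ζ < η} v ζ`, `η ≤ 𝔠`, which are continuous at limit ordinals, with `s 𝔠 = x`. -/
def IsTransfiniteSum (v : ContIndex → E) (x : E) : Prop :=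
  ∃ s : Ordinal.{0} → E, s 0 = 0 ∧
    (∀ η : ContIndex, s (Order.succ η.1) = s η.1 + v η) ∧
    (∀ η ≤ (Cardinal.continuum.{0}).ord, Order.IsSuccLimit η → Tendsto s (𝓝[<] η) (𝓝 (s η))) ∧
    s (Cardinal.continuum.{0}).ord = x

/-- `(e η)_{η < 𝔠}` is a (transfinite) Schauder basis of `E`, of length `𝔠`. -/
def IsTransfiniteBasis (e : ContIndex → E) : Prop :=
  ∀ x : E, ∃! a : ContIndex → ℝ, IsTransfiniteSum (fun η => a η • e η) x

/-- Omitting terms of a finite linear combination of the vectors `e i` does not increase the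
norm. -/
def IsSuppressionUnconditional {ι : Type*} (e : ι → E) : Prop :=
  ∀ F G : Finset ι, G ⊆ F → ∀ a : ι → ℝ, ‖∑ i ∈ G, a i • e i‖ ≤ ‖∑ i ∈ F, a i • e i‖

/-- For every bounded functional `f` and `ε > 0`, `|f (e i)| < ε` for all but finitely many `i`. -/
def IsWeaklyNull {ι : Type*} (e : ι → E) : Prop :=
  ∀ f : StrongDual ℝ E, Tendsto (fun i => f (e i)) cofinite (𝓝 0)

/-- The sequence `x` generates the spreading model `p`, a seminorm on `c₀₀(ℕ)`: for all
`a₀, …, a_k`, the norms `‖∑ a_i x_{m_i}‖` converge to `p (∑ a_i e_i)` as `m₀ < m₁ < ⋯` and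
`m₀ → ∞`. -/
def GeneratesSpreadingModel (x : ℕ → E) (p : Seminorm ℝ (ℕ →₀ ℝ)) : Prop :=
  ∀ a : ℕ →₀ ℝ, ∀ ε > 0, ∃ N : ℕ, ∀ m : ℕ → ℕ, StrictMono m → N ≤ m 0 →
    |‖a.sum fun i c => c • x (m i)‖ - p a| < ε

/-- Some subsequence of `x` generates the spreading model `p`. -/
def AdmitsSpreadingModel (x : ℕ → E) (p : Seminorm ℝ (ℕ →₀ ℝ)) : Prop :=
  ∃ k : ℕ → ℕ, StrictMono k ∧ GeneratesSpreadingModel (x ∘ k) p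

/-- The unit vectors of `(c₀₀(ℕ), p)` are equivalent to the usual basis of `ℓ₁`. -/
def IsEquivToL1 (p : Seminorm ℝ (ℕ →₀ ℝ)) : Prop :=
  ∃ c C : ℝ, 0 < c ∧ ∀ a : ℕ →₀ ℝ,
    c * (a.sum fun _ t => |t|) ≤ p a ∧ p a ≤ C * (a.sum fun _ t => |t|)

/-- `x` has a spreading model, and all of its spreading models are equivalent to the usual basis
of `ℓ₁`. -/
def AdmitsOnlyL1 (x : ℕ → E) : Prop :=
  (∃ p, AdmitsSpreadingModel x p) ∧ ∀ p, AdmitsSpreadingModel x p → IsEquivToL1 p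

end General

end

noncomputable section

/-! Everything rests on two properties of `𝒢_n`: it is hereditary, and it is closed under pointwise
limits (`GFam.hereditary`, `GFam.exists_ultrafilter_limit`). For the second, a member of `𝒢_{n+1}`
outside `𝒢_n` is covered by `d` simpler sets and branches off some `σ` at levels at least `d`. Along
an ultrafilter either `d` stays bounded, and the limit is a finite union of simpler limits, or `d`
is unbounded, and any two points of the limit agree at every coordinate. So limits are finite sets,
and by heredity they belong to the family.

Saturation: give `F` a weight in `(1, 2]` that strictly decreases with `|F|`. For `y` in the
weighted ball only finitely many `F` come close to norming `y`: otherwise a limit `L` of such sets,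
strictly smaller than they are, would exceed the bound because of its larger weight
(`IsNormedBy.finite_almost_norming`). Hence the ball depends locally on finitely many functionals,
and a greedy construction finds `c₀` in every infinite dimensional closed subspace
(`LocallyFiniteDetermined.exists_c0_le`). A similar greedy argument shows that the basis is weakly
null.

Basis: heredity makes every coordinate projection a contraction. This gives suppression
unconditionality, and the projections onto initial segments are the partial sums of the transfinite
series.

Spreading models: by compactness of the Cantor set, distinct points have a subsequence that branches
off some `σ` at increasing levels. Far along it every set of prescribed size lies in `𝒢_1`, so the
norm of a combination is exactly the larger of the sums of the positive and of the negative parts of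
its coefficients. -/

theorem meetLen_eq_of_lt {σ ρ τ : CantorSet} (h1 : σ ≠ ρ) (h2 : ρ ≠ τ)
    (h : meetLen σ ρ < meetLen ρ τ) : σ ≠ τ ∧ meetLen σ τ = meetLen σ ρ := by
  unfold meetLen at *
  have hd : σ (PiNat.firstDiff σ ρ) ≠ ρ (PiNat.firstDiff σ ρ) := PiNat.apply_firstDiff_ne h1
  have he : ρ (PiNat.firstDiff σ ρ) = τ (PiNat.firstDiff σ ρ) :=
    PiNat.apply_eq_of_lt_firstDiff h
  have hne : σ ≠ τ := by
    rintro rfl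
    exact hd he.symm
  refine ⟨hne, le_antisymm ?_ ?_⟩
  · by_contra hc
    push Not at hc
    exact hd ((PiNat.apply_eq_of_lt_firstDiff hc).trans he.symm)
  · by_contra hc
    push Not at hc
    apply PiNat.apply_firstDiff_ne hne
    exact (PiNat.apply_eq_of_lt_firstDiff hc).trans
      (PiNat.apply_eq_of_lt_firstDiff (hc.trans h))

/-! ### Branching levels and heredity of the pairs. -/

namespace GPair

variable {n : ℕ} {F : Finset CantorSet} {σ : CantorSet} {p q : ℕ}

/-- In a skipped union `σ` leaves `s i` before any element of `G i` does, so those elements leave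
`σ` exactly where `s i` does. -/
theorem vmin_le (h : GPair n F σ p q) :
    p ≤ q ∧ ∀ τ ∈ F, σ ≠ τ ∧ p ≤ meetLen σ τ := by
  induction h with
  | base m τ F σ hF hne hpos hmono hcard =>
    refine ⟨hmono.monotone (Fin.zero_le _), fun t ht => ?_⟩
    rw [← Finset.mem_coe, hF] at ht
    obtain ⟨i, rfl⟩ := ht
    exact ⟨hne i, hmono.monotone (Fin.zero_le i)⟩
  | lift n F σ p q h ih => exact ih
  | skipped n m G s p q F σ hG hF hdisj hne hpos hmono hmin hcard ih =>
    refine ⟨hmono.monotone (Fin.zero_le _), fun t ht => ?_⟩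
    rw [← Finset.mem_coe, hF, Set.mem_iUnion] at ht
    obtain ⟨i, hi⟩ := ht
    obtain ⟨h1, h2⟩ := (ih i).2 t hi
    obtain ⟨h3, h4⟩ := meetLen_eq_of_lt (hne i) h1 ((hmin i).trans_le h2)
    exact ⟨h3, h4 ▸ hmono.monotone (Fin.zero_le i)⟩
  | attached n m G p q F σ hG hF hdisj hlt hcard ih =>
    have hq : StrictMono q := Fin.strictMono_iff_lt_succ.2 fun i =>
      (hlt i).trans_le (ih i.succ).1
    have hp : StrictMono p := Fin.strictMono_iff_lt_succ.2 fun i =>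
      (ih i.castSucc).1.trans_lt (hlt i)
    refine ⟨(ih 0).1.trans (hq.monotone (Fin.zero_le _)), fun t ht => ?_⟩
    rw [← Finset.mem_coe, hF, Set.mem_iUnion] at ht
    obtain ⟨i, hi⟩ := ht
    exact ⟨((ih i).2 t hi).1, (hp.monotone (Fin.zero_le i)).trans ((ih i).2 t hi).2⟩

/-- Pieces that miss `E` are dropped and the others renumbered in order: their number does not grow
and the first level does not fall, so the cardinality condition survives. The bounds on `p'` and
`q'` are carried along because the induction needs them for the separation conditions. -/
theorem hereditary (h : GPair n F σ p q) :
    ∀ E ⊆ F, E.Nonempty → ∃ p' q', p ≤ p' ∧ q' ≤ q ∧ GPair n E σ p' q' := by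
  classical
  induction h with
  | base m τ F σ hF hne hpos hmono hcard =>
    intro E hE hEne
    set I : Finset (Fin (m + 1)) := Finset.univ.filter fun i => τ i ∈ E with hI
    have hcov : ∀ t ∈ E, ∃ i ∈ I, τ i = t := fun t ht => by
      have := hE ht
      rw [← Finset.mem_coe, hF] at this
      obtain ⟨i, rfl⟩ := this
      exact ⟨i, by simpa [hI] using ht, rfl⟩
    have hIne : I.Nonempty := by
      obtain ⟨t, ht⟩ := hEne
      obtain ⟨i, hi, -⟩ := hcov t ht
      exact ⟨i, hi⟩
    obtain ⟨k, hk⟩ := Nat.exists_eq_succ_of_ne_zero (Finset.card_pos.2 hIne).ne'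
    set ι := I.orderEmbOfFin hk
    have hle : meetLen σ (τ 0) ≤ meetLen σ (τ (ι 0)) := hmono.monotone (Fin.zero_le _)
    have hkm : k + 1 ≤ m + 1 := by
      have := Finset.card_le_univ I
      rw [hk, Fintype.card_fin] at this
      exact this
    refine ⟨_, _, hle, hmono.monotone (Fin.le_last (ι (Fin.last k))),
      GPair.base k (fun j => τ (ι j)) E σ ?_ (fun j => hne _) (by omega)
        (fun i j hij => hmono (ι.strictMono hij)) (by omega)⟩
    ext t
    simp only [Finset.mem_coe, Set.mem_range]
    constructor
    · intro ht
      obtain ⟨i, hi, rfl⟩ := hcov t ht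
      have : i ∈ Set.range ι := by simpa [ι] using hi
      obtain ⟨j, rfl⟩ := this
      exact ⟨j, rfl⟩
    · rintro ⟨j, rfl⟩
      have := I.orderEmbOfFin_mem hk j
      exact (Finset.mem_filter.1 this).2
  | lift n F σ p q h ih =>
    intro E hE hEne
    obtain ⟨p', q', h1, h2, h3⟩ := ih E hE hEne
    exact ⟨p', q', h1, h2, h3.lift⟩
  | skipped n m G s p q F σ hG hF hdisj hne hpos hmono hmin hcard ih =>
    intro E hE hEne
    set I : Finset (Fin (m + 1)) := Finset.univ.filter fun i => (E ∩ G i).Nonempty with hI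
    have hcov : ∀ t ∈ E, ∃ i ∈ I, t ∈ E ∩ G i := fun t ht => by
      have := hE ht
      rw [← Finset.mem_coe, hF, Set.mem_iUnion] at this
      obtain ⟨i, hi⟩ := this
      have h1 : t ∈ E ∩ G i := Finset.mem_inter.2 ⟨ht, hi⟩
      exact ⟨i, by simpa [hI] using ⟨t, h1⟩, h1⟩
    have hIne : I.Nonempty := by
      obtain ⟨t, ht⟩ := hEne
      obtain ⟨i, hi, -⟩ := hcov t ht
      exact ⟨i, hi⟩
    obtain ⟨k, hk⟩ := Nat.exists_eq_succ_of_ne_zero (Finset.card_pos.2 hIne).ne'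
    set ι := I.orderEmbOfFin hk
    have hle : meetLen σ (s 0) ≤ meetLen σ (s (ι 0)) := hmono.monotone (Fin.zero_le _)
    have hkm : k + 1 ≤ m + 1 := by
      have := Finset.card_le_univ I
      rw [hk, Fintype.card_fin] at this
      exact this
    have hsub : ∀ j, (E ∩ G (ι j)).Nonempty := fun j =>
      (Finset.mem_filter.1 (I.orderEmbOfFin_mem hk j)).2
    choose p' q' hp' hq' hG' using fun j => ih (ι j) _ (Finset.inter_subset_right) (hsub j)
    refine ⟨_, _, hle, hmono.monotone (Fin.le_last (ι (Fin.last k))),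
      GPair.skipped n k (fun j => E ∩ G (ι j)) (fun j => s (ι j)) p' q' E σ hG' ?_
        (fun i j hij => (hdisj _ _ (ι.injective.ne hij)).mono Finset.inter_subset_right
          Finset.inter_subset_right) (fun j => hne _) (by omega)
        (fun i j hij => hmono (ι.strictMono hij)) (fun j => (hmin _).trans_le (hp' j)) (by omega)⟩
    ext t
    simp only [Finset.mem_coe, Set.mem_iUnion]
    constructor
    · intro ht
      obtain ⟨i, hi, hti⟩ := hcov t ht
      have : i ∈ Set.range ι := by simpa [ι] using hi
      obtain ⟨j, rfl⟩ := this
      exact ⟨j, hti⟩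
    · rintro ⟨j, hj⟩
      exact (Finset.mem_inter.1 hj).1
  | attached n m G p q F σ hG hF hdisj hlt hcard ih =>
    intro E hE hEne
    have hpq : ∀ i, p i ≤ q i := fun i => (hG i).vmin_le.1
    have hq : StrictMono q := Fin.strictMono_iff_lt_succ.2 fun i =>
      (hlt i).trans_le (hpq i.succ)
    have hp : StrictMono p := Fin.strictMono_iff_lt_succ.2 fun i =>
      (hpq i.castSucc).trans_lt (hlt i)
    -- Neighbours among the surviving pieces need not have been neighbours before.
    have hqp : ∀ i j, i < j → q i < p j := by
      intro i j hij
      obtain ⟨j', rfl⟩ := Fin.exists_succ_eq.2 (Fin.pos_iff_ne_zero.1 ((Fin.zero_le i).trans_lt hij))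
      exact (hq.monotone (Fin.le_castSucc_iff.2 hij)).trans_lt (hlt j')
    set I : Finset (Fin (m + 1)) := Finset.univ.filter fun i => (E ∩ G i).Nonempty with hI
    have hcov : ∀ t ∈ E, ∃ i ∈ I, t ∈ E ∩ G i := fun t ht => by
      have := hE ht
      rw [← Finset.mem_coe, hF, Set.mem_iUnion] at this
      obtain ⟨i, hi⟩ := this
      have h1 : t ∈ E ∩ G i := Finset.mem_inter.2 ⟨ht, hi⟩
      exact ⟨i, by simpa [hI] using ⟨t, h1⟩, h1⟩
    have hIne : I.Nonempty := by
      obtain ⟨t, ht⟩ := hEne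
      obtain ⟨i, hi, -⟩ := hcov t ht
      exact ⟨i, hi⟩
    obtain ⟨k, hk⟩ := Nat.exists_eq_succ_of_ne_zero (Finset.card_pos.2 hIne).ne'
    set ι := I.orderEmbOfFin hk
    have hkm : k + 1 ≤ m + 1 := by
      have := Finset.card_le_univ I
      rw [hk, Fintype.card_fin] at this
      exact this
    have hsub : ∀ j, (E ∩ G (ι j)).Nonempty := fun j =>
      (Finset.mem_filter.1 (I.orderEmbOfFin_mem hk j)).2
    choose p' q' hp' hq' hG' using fun j => ih (ι j) _ (Finset.inter_subset_right) (hsub j)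
    have hle : p 0 ≤ p' 0 := (hp.monotone (Fin.zero_le _)).trans (hp' 0)
    refine ⟨_, _, hle, (hq' (Fin.last k)).trans (hq.monotone (Fin.le_last _)),
      GPair.attached n k (fun j => E ∩ G (ι j)) p' q' E σ hG' ?_
        (fun i j hij => (hdisj _ _ (ι.injective.ne hij)).mono Finset.inter_subset_right
          Finset.inter_subset_right)
        (fun i => (hq' _).trans_lt ((hqp _ _ (ι.strictMono Fin.castSucc_lt_succ)).trans_le
          (hp' _))) (by omega)⟩
    ext t
    simp only [Finset.mem_coe, Set.mem_iUnion]
    constructor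
    · intro ht
      obtain ⟨i, hi, hti⟩ := hcov t ht
      have : i ∈ Set.range ι := by simpa [ι] using hi
      obtain ⟨j, rfl⟩ := this
      exact ⟨j, hti⟩
    · rintro ⟨j, hj⟩
      exact (Finset.mem_inter.1 hj).1

end GPair

/-! ### Compactness of the families. -/

namespace GFam

theorem hereditary {n : ℕ} {F E : Finset CantorSet} (hF : F ∈ GFam n) (hE : E ⊆ F) :
    E ∈ GFam n := by
  rcases E.eq_empty_or_nonempty with rfl | hne
  · exact empty_mem n
  rcases hF with rfl | ⟨σ, p, q, h⟩
  · exact absurd (hne.mono hE) (by simp)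
  · obtain ⟨p', q', -, -, h'⟩ := h.hereditary E hE hne
    exact Or.inr ⟨σ, p', q', h'⟩

/-- Lets the compactness induction start at `0`; the step to `𝒢_1` then uses covers by singletons.
-/
theorem zero : GFam 0 = {∅} := by
  have key : ∀ {n : ℕ} {F : Finset CantorSet} {σ : CantorSet} {p q : ℕ},
      GPair n F σ p q → n ≠ 0 := by
    intro n F σ p q h
    cases h <;> omega
  ext F
  constructor
  · rintro (rfl | ⟨σ, p, q, h⟩)
    · rfl
    · exact absurd rfl (key h)
  · rintro rfl
    exact empty_mem 0

/-- A member of `𝒢_{n+1}` is in `𝒢_n`, or it is covered by `d` sets that are singletons or members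
of `𝒢_n`, and all of its elements split from a common branch above the level `d`. -/
theorem decomposition {n : ℕ} {F : Finset CantorSet} (hF : F ∈ GFam (n + 1)) :
    F ∈ GFam n ∨ ∃ (σ : CantorSet) (d : ℕ) (G : ℕ → Finset CantorSet),
      (∀ j, G j ∈ GFam n ∨ (G j).card ≤ 1) ∧ (∀ τ ∈ F, ∃ j < d, τ ∈ G j) ∧
      ∀ τ ∈ F, σ ≠ τ ∧ d ≤ meetLen σ τ := by
  rcases hF with rfl | ⟨σ, p, q, h⟩
  · exact Or.inl (empty_mem n)
  have hmin := h.vmin_le.2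
  cases h with
  | base m τ _ _ hF hne hpos hmono hcard =>
    refine Or.inr ⟨σ, m + 1, fun j => if h : j < m + 1 then {τ ⟨j, h⟩} else ∅,
      fun j => Or.inr ?_, fun t ht => ?_, fun t ht => ⟨(hmin t ht).1, hcard.trans (hmin t ht).2⟩⟩
    · dsimp only
      split_ifs <;> simp
    · rw [← Finset.mem_coe, hF] at ht
      obtain ⟨i, rfl⟩ := ht
      exact ⟨i, i.2, by simp only [i.2, dif_pos, Fin.eta, Finset.mem_singleton]⟩
  | lift _ _ _ _ _ h => exact Or.inl (Or.inr ⟨_, _, _, h⟩)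
  | skipped _ m G s p q _ _ hG hF hdisj hne hpos hmono hmin' hcard =>
    refine Or.inr ⟨σ, m + 1, fun j => if h : j < m + 1 then G ⟨j, h⟩ else ∅,
      fun j => Or.inl ?_, fun t ht => ?_, fun t ht => ⟨(hmin t ht).1, hcard.trans (hmin t ht).2⟩⟩
    · dsimp only
      split_ifs
      · exact Or.inr ⟨_, _, _, hG _⟩
      · exact empty_mem n
    · rw [← Finset.mem_coe, hF, Set.mem_iUnion] at ht
      obtain ⟨i, hi⟩ := ht
      exact ⟨i, i.2, by simpa only [i.2, dif_pos, Fin.eta] using Finset.mem_coe.1 hi⟩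
  | attached _ m G p q _ _ hG hF hdisj hlt hcard =>
    refine Or.inr ⟨σ, m + 1, fun j => if h : j < m + 1 then G ⟨j, h⟩ else ∅,
      fun j => Or.inl ?_, fun t ht => ?_, fun t ht => ⟨(hmin t ht).1, hcard.trans (hmin t ht).2⟩⟩
    · dsimp only
      split_ifs
      · exact Or.inr ⟨_, _, _, hG _⟩
      · exact empty_mem n
    · rw [← Finset.mem_coe, hF, Set.mem_iUnion] at ht
      obtain ⟨i, hi⟩ := ht
      exact ⟨i, i.2, by simpa only [i.2, dif_pos, Fin.eta] using Finset.mem_coe.1 hi⟩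

/-- The pointwise limits of members of `𝒢_n` are finite sets. -/
theorem finite_ultrafilter_limit (n : ℕ) {α : Type*} (U : Ultrafilter α)
    (F : α → Finset CantorSet) (hF : ∀ᶠ i in U, F i ∈ GFam n) :
    {τ | ∀ᶠ i in U, τ ∈ F i}.Finite := by
  induction n generalizing F with
  | zero =>
    convert Set.finite_empty (α := CantorSet)
    ext τ
    simp only [Set.mem_ofPred_eq, Set.mem_empty_iff_false, iff_false]
    intro hτ
    obtain ⟨i, h1, h2⟩ := (hF.and hτ).exists
    rw [zero, Set.mem_singleton_iff] at h1
    simp [h1] at h2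
  | succ n ih =>
    have hdec := hF.mono fun i hi => decomposition hi
    rcases Ultrafilter.eventually_or.1 hdec with h | h
    · exact ih F h
    have : ∀ i, ∃ (σ : CantorSet) (d : ℕ) (G : ℕ → Finset CantorSet),
        (∃ (σ : CantorSet) (d : ℕ) (G : ℕ → Finset CantorSet),
      (∀ j, G j ∈ GFam n ∨ (G j).card ≤ 1) ∧ (∀ τ ∈ F i, ∃ j < d, τ ∈ G j) ∧
      ∀ τ ∈ F i, σ ≠ τ ∧ d ≤ meetLen σ τ) →
      (∀ j, G j ∈ GFam n ∨ (G j).card ≤ 1) ∧ (∀ τ ∈ F i, ∃ j < d, τ ∈ G j) ∧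
      ∀ τ ∈ F i, σ ≠ τ ∧ d ≤ meetLen σ τ := fun i => by
      by_cases hi : ∃ (σ : CantorSet) (d : ℕ) (G : ℕ → Finset CantorSet),
        (∀ j, G j ∈ GFam n ∨ (G j).card ≤ 1) ∧ (∀ τ ∈ F i, ∃ j < d, τ ∈ G j) ∧
        ∀ τ ∈ F i, σ ≠ τ ∧ d ≤ meetLen σ τ
      · obtain ⟨σ, d, G, hi'⟩ := hi
        exact ⟨σ, d, G, fun _ => hi'⟩
      · exact ⟨fun _ => true, 0, fun _ => ∅, fun h => absurd h hi⟩
    choose σ d G hG using this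
    replace hG := h.mono fun i hi => hG i hi
    -- With boundedly many pieces, the ultrafilter selects for each limit point one index `j` with
    -- `τ ∈ G i j` for almost all `i`.
    by_cases hd : ∃ D, ∀ᶠ i in U, d i < D
    · obtain ⟨D, hD⟩ := hd
      have hfin : ∀ j, {τ | ∀ᶠ i in U, τ ∈ G i j}.Finite := fun j => by
        rcases Ultrafilter.eventually_or.1 (hG.mono fun i hi => hi.1 j) with h | h
        · exact ih _ h
        · refine Set.Subsingleton.finite fun τ hτ τ' hτ' => ?_
          obtain ⟨i, ⟨h1, h2⟩, h3⟩ := ((h.and hτ).and hτ').exists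
          exact Finset.card_le_one.1 h1 _ h2 _ h3
      refine ((Set.finite_lt_nat D).biUnion fun j _ => hfin j).subset fun τ hτ => ?_
      have h1 : ∀ᶠ i in U, ∃ j ∈ Set.Iio D, τ ∈ G i j := by
        filter_upwards [hG, hτ, hD] with i h1 h2 h3
        obtain ⟨j, hj, hj'⟩ := h1.2.1 τ h2
        exact ⟨j, hj.trans h3, hj'⟩
      rw [Ultrafilter.eventually_exists_mem_iff (Set.finite_Iio D)] at h1
      obtain ⟨j, hj, hj'⟩ := h1
      exact Set.mem_biUnion (show j ∈ {i | i < D} from hj) hj'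
    -- Two limit points both agree with `σ i` at coordinate `k` as soon as `d i ≥ k + 1`, hence they
    -- agree with each other.
    · push Not at hd
      refine Set.Subsingleton.finite fun τ hτ τ' hτ' => ?_
      ext k
      obtain ⟨i, ⟨⟨h1, h2⟩, h3⟩, h4⟩ := (((hG.and hτ).and hτ').and (hd (k + 1))).exists
      have a1 := (h1.2.2 τ h2).2
      have a2 := (h1.2.2 τ' h3).2
      exact (PiNat.apply_eq_of_lt_firstDiff (Nat.lt_of_succ_le (h4.trans a1))).symm.trans
        (PiNat.apply_eq_of_lt_firstDiff (Nat.lt_of_succ_le (h4.trans a2)))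

/-- The pointwise limits of members of `𝒢_n` belong to `𝒢_n`. -/
theorem exists_ultrafilter_limit (n : ℕ) {α : Type*} (U : Ultrafilter α)
    (F : α → Finset CantorSet) (hF : ∀ᶠ i in U, F i ∈ GFam n) :
    ∃ L ∈ GFam n, ∀ τ, τ ∈ L ↔ ∀ᶠ i in U, τ ∈ F i := by
  have hfin := finite_ultrafilter_limit n U F hF
  refine ⟨hfin.toFinset, ?_, fun τ => by simp⟩
  -- The limit is finite, so it is contained in a single member `F i`, and heredity applies.
  have hsub : ∀ᶠ i in U, ∀ τ ∈ hfin.toFinset, τ ∈ F i :=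
    (Filter.eventually_all_finset _).2 fun τ hτ => by simpa using hτ
  obtain ⟨i, h1, h2⟩ := (hF.and hsub).exists
  exact hereditary h1 h2

theorem mono_one {n : ℕ} (hn : n ≠ 0) {F : Finset CantorSet} (hF : F ∈ GFam 1) : F ∈ GFam n := by
  rcases hF with rfl | ⟨σ, p, q, h⟩
  · exact empty_mem n
  refine Or.inr ⟨σ, p, q, ?_⟩
  induction n, Nat.one_le_iff_ne_zero.2 hn using Nat.le_induction with
  | base => exact h
  | succ k hk ih => exact (ih (by omega)).lift

end GFam

/-! ### Norms given by compact hereditary families; the weighted ball and weak nullity. -/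

/-- `T` maps the finitely supported functions on `ι` onto a dense subspace of `E`, the norm of
which is `sup {|∑ i ∈ F, x i| : F ∈ 𝓕}`, for a hereditary family `𝓕` of finite sets which is closed
under pointwise limits and covers `ι`. -/
structure IsNormedBy {ι E : Type*} [NormedAddCommGroup E] [NormedSpace ℝ E]
    (𝓕 : Set (Finset ι)) (T : (ι →₀ ℝ) →ₗ[ℝ] E) : Prop where
  dense : DenseRange T
  abs_sum_le : ∀ x, ∀ F ∈ 𝓕, |∑ i ∈ F, x i| ≤ ‖T x‖
  norm_le : ∀ x r, (∀ F ∈ 𝓕, |∑ i ∈ F, x i| ≤ r) → ‖T x‖ ≤ r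
  empty_mem : ∅ ∈ 𝓕
  singleton_mem : ∀ i, {i} ∈ 𝓕
  hereditary : ∀ F ∈ 𝓕, ∀ G ⊆ F, G ∈ 𝓕
  limit : ∀ U : Ultrafilter (Finset ι), 𝓕 ∈ U → ∃ L ∈ 𝓕, ∀ i,
    i ∈ L ↔ ∀ᶠ F in (U : Filter (Finset ι)), i ∈ F

/-- The `i`-th coordinate, extended to the closure of the range of `T`. -/
def coordFunctional {ι E : Type*} [NormedAddCommGroup E] [NormedSpace ℝ E]
    (T : (ι →₀ ℝ) →ₗ[ℝ] E) (i : ι) : StrongDual ℝ E :=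
  (Finsupp.lapply i : (ι →₀ ℝ) →ₗ[ℝ] ℝ).extendOfNorm T

/-- The sum of the coordinates in `F`. -/
def sumFunctional {ι E : Type*} [NormedAddCommGroup E] [NormedSpace ℝ E]
    (T : (ι →₀ ℝ) →ₗ[ℝ] E) (F : Finset ι) : StrongDual ℝ E :=
  ∑ i ∈ F, coordFunctional T i

/-- A weight in `(1, 2]` which is strictly decreasing. -/
def cardWeight (k : ℕ) : ℝ := 1 + 1 / ((k : ℝ) + 1)

theorem one_le_cardWeight (k : ℕ) : 1 ≤ cardWeight k := by
  have : 0 ≤ 1 / ((k : ℝ) + 1) := by positivity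
  unfold cardWeight
  linarith

theorem cardWeight_le_two (k : ℕ) : cardWeight k ≤ 2 := by
  have : 1 / ((k : ℝ) + 1) ≤ 1 := by
    rw [div_le_one (by positivity)]
    linarith [(Nat.cast_nonneg k : (0 : ℝ) ≤ k)]
  unfold cardWeight
  linarith

theorem cardWeight_strictAnti : StrictAnti cardWeight := by
  intro a b hab
  unfold cardWeight
  have : (a : ℝ) < b := by exact_mod_cast hab
  have := one_div_lt_one_div_of_lt (by positivity : (0 : ℝ) < a + 1) (by linarith : (a : ℝ) + 1 < b + 1)
  linarith

/-- The unit ball of the norm `sup {w(|F|) |∑_{i ∈ F} y_i| : F ∈ 𝓕}`. -/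
def weightedBall {ι E : Type*} [NormedAddCommGroup E] [NormedSpace ℝ E]
    (𝓕 : Set (Finset ι)) (T : (ι →₀ ℝ) →ₗ[ℝ] E) : Set E :=
  {y | ∀ F ∈ 𝓕, cardWeight F.card * |sumFunctional T F y| ≤ 1}

namespace IsNormedBy

variable {ι E : Type*} [NormedAddCommGroup E] [NormedSpace ℝ E]
  {𝓕 : Set (Finset ι)} {T : (ι →₀ ℝ) →ₗ[ℝ] E}

theorem zero_mem_weightedBall : (0 : E) ∈ weightedBall 𝓕 T := fun F _ => by simp

theorem isClosed_weightedBall : IsClosed (weightedBall 𝓕 T) := by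
  have : weightedBall 𝓕 T =
      ⋂ F ∈ 𝓕, {y | cardWeight F.card * |sumFunctional T F y| ≤ 1} := by
    ext y
    simp [weightedBall]
  rw [this]
  exact isClosed_biInter fun F _ => isClosed_le (by fun_prop) (by fun_prop)

variable (h : IsNormedBy 𝓕 T)
include h

theorem abs_apply_le (x : ι →₀ ℝ) (i : ι) : |x i| ≤ ‖T x‖ := by
  simpa using h.abs_sum_le x {i} (h.singleton_mem i)

theorem coordFunctional_apply (x : ι →₀ ℝ) (i : ι) : coordFunctional T i (T x) = x i :=
  LinearMap.extendOfNorm_eq h.dense ⟨1, fun x => by simpa using h.abs_apply_le x i⟩ x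

theorem sumFunctional_apply (x : ι →₀ ℝ) (F : Finset ι) :
    sumFunctional T F (T x) = ∑ i ∈ F, x i := by
  simp [sumFunctional, _root_.sum_apply, h.coordFunctional_apply]

theorem abs_sumFunctional_le {F : Finset ι} (hF : F ∈ 𝓕) (y : E) :
    |sumFunctional T F y| ≤ ‖y‖ := by
  refine h.dense.induction (P := fun y => |sumFunctional T F y| ≤ ‖y‖) ?_
    (isClosed_le (by fun_prop) (by fun_prop)) y
  rintro _ ⟨x, rfl⟩
  rw [h.sumFunctional_apply]
  exact h.abs_sum_le x F hF

theorem norm_le_of_forall {y : E} {r : ℝ} (hr : ∀ F ∈ 𝓕, |sumFunctional T F y| ≤ r) :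
    ‖y‖ ≤ r := by
  refine le_of_forall_pos_le_add fun ε hε => ?_
  obtain ⟨_, ⟨x, rfl⟩, hx⟩ := Metric.mem_closure_iff.1 (h.dense y) (ε / 2) (by positivity)
  rw [dist_eq_norm] at hx
  have h1 : ‖T x‖ ≤ r + ε / 2 := by
    refine h.norm_le x _ fun F hF => ?_
    rw [← h.sumFunctional_apply]
    have h2 := h.abs_sumFunctional_le hF (y - T x)
    have h3 := hr F hF
    rw [map_sub, abs_sub_comm] at h2
    have h4 := abs_sub_abs_le_abs_sub (sumFunctional T F (T x)) (sumFunctional T F y)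
    linarith
  have h2 : ‖y‖ ≤ ‖T x‖ + ‖y - T x‖ := by
    simpa using norm_add_le (T x) (y - T x)
  linarith

theorem norm_single (i : ι) : ‖T (Finsupp.single i 1)‖ = 1 := by
  classical
  refine le_antisymm (h.norm_le _ _ fun F _ => ?_) ?_
  · rw [Finset.sum_congr rfl fun j _ => Finsupp.single_apply, Finset.sum_ite_eq]
    split_ifs <;> simp
  · simpa using h.abs_apply_le (Finsupp.single i 1) i

/-- On finitely supported vectors the values are eventually constant along `U`; density and the
uniform bound `abs_sumFunctional_le` give the rest. -/
theorem tendsto_sumFunctional {U : Ultrafilter (Finset ι)} (hU : 𝓕 ∈ U) {L : Finset ι}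
    (hL : L ∈ 𝓕) (hlim : ∀ i, i ∈ L ↔ ∀ᶠ F in (U : Filter (Finset ι)), i ∈ F) (y : E) :
    Tendsto (fun F => sumFunctional T F y) U (𝓝 (sumFunctional T L y)) := by
  classical
  rw [Metric.tendsto_nhds]
  intro ε hε
  obtain ⟨_, ⟨x, rfl⟩, hx⟩ := Metric.mem_closure_iff.1 (h.dense y) (ε / 2) (by positivity)
  rw [dist_eq_norm] at hx
  have hev : ∀ᶠ F : Finset ι in U, ∀ i ∈ x.support, i ∈ F ↔ i ∈ L := by
    refine (Filter.eventually_all_finset _).2 fun i _ => ?_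
    by_cases hi : i ∈ L
    · exact ((hlim i).1 hi).mono fun F hF => by simp [hi, hF]
    · refine (Ultrafilter.eventually_not.2 fun hc => hi ((hlim i).2 hc)).mono fun F hF => ?_
      simp [hi, hF]
  filter_upwards [hev, hU] with F hF hF'
  have hsum : ∀ G : Finset ι, ∑ i ∈ G, x i = ∑ i ∈ x.support, if i ∈ G then x i else 0 := by
    intro G
    rw [← Finset.sum_filter, Finset.filter_mem_eq_inter, Finset.inter_comm,
      ← Finset.filter_mem_eq_inter, Finset.sum_filter_of_ne]
    intro i _ hi
    simpa using hi
  have heq : sumFunctional T F (T x) = sumFunctional T L (T x) := by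
    rw [h.sumFunctional_apply, h.sumFunctional_apply, hsum, hsum]
    refine Finset.sum_congr rfl fun i hi => ?_
    simp only [hF i hi]
  have h1 := h.abs_sumFunctional_le hF' (y - T x)
  have h2 := h.abs_sumFunctional_le hL (y - T x)
  rw [map_sub] at h1 h2
  rw [Real.dist_eq]
  rw [heq] at h1
  rw [abs_sub_comm] at h2
  have h3 := abs_sub_le (sumFunctional T F y) (sumFunctional T L (T x)) (sumFunctional T L y)
  linarith

theorem norm_le_one_of_mem_weightedBall {y : E} (hy : y ∈ weightedBall 𝓕 T) : ‖y‖ ≤ 1 :=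
  h.norm_le_of_forall fun F hF =>
    (le_mul_of_one_le_left (abs_nonneg _) (one_le_cardWeight _)).trans (hy F hF)

/-- Otherwise take a nonprincipal ultrafilter of sets `F` whose weighted values at `y` are
eventually above every number below `1`. Its limit `L` is properly contained in almost every `F`, so
`w(|L| + 1) |L(y)| ≥ 1`; as the weight is strictly decreasing, `w(|L|) |L(y)| > 1`, which is
impossible in the ball. -/
theorem finite_almost_norming {y : E} (hy : y ∈ weightedBall 𝓕 T) :
    ∃ η > 0, {F ∈ 𝓕 | 1 - η < cardWeight F.card * |sumFunctional T F y|}.Finite := by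
  by_contra! hc
  set S : ℕ → Set (Finset ι) := fun k =>
    {F ∈ 𝓕 | 1 - 1 / ((k : ℝ) + 1) < cardWeight F.card * |sumFunctional T F y|} with hS
  have hSinf : ∀ k, (S k).Infinite := fun k => hc _ (by positivity)
  have hSanti : Antitone S := fun a b hab F hF => by
    refine ⟨hF.1, lt_of_le_of_lt ?_ hF.2⟩
    have := one_div_le_one_div_of_le (by positivity : (0 : ℝ) < a + 1)
      (by gcongr : (a : ℝ) + 1 ≤ b + 1)
    linarith
  have hne : (⨅ k, cofinite ⊓ 𝓟 (S k)).NeBot := by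
    refine iInf_neBot_of_directed' ?_ fun k => ?_
    · refine directed_of_isDirected_le fun a b hab => ?_
      exact inf_le_inf_left _ (principal_mono.2 (hSanti hab))
    · exact (hSinf k).cofinite_inf_principal_neBot
  set U := Ultrafilter.of (⨅ k, cofinite ⊓ 𝓟 (S k)) with hUdef
  have hU : (U : Filter (Finset ι)) ≤ ⨅ k, cofinite ⊓ 𝓟 (S k) := Ultrafilter.of_le _
  have hUS : ∀ k, ∀ᶠ F : Finset ι in U, F ∈ S k := fun k =>
    (hU.trans ((iInf_le _ k).trans inf_le_right)) (mem_principal_self _)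
  have hUc : (U : Filter (Finset ι)) ≤ cofinite := hU.trans ((iInf_le _ 0).trans inf_le_left)
  have hU𝓕 : 𝓕 ∈ U := (hUS 0).mono fun F hF => hF.1
  obtain ⟨L, hL, hlim⟩ := h.limit U hU𝓕
  have hlt : ∀ᶠ F : Finset ι in U, L.card < F.card := by
    have h1 : ∀ᶠ F : Finset ι in U, ∀ i ∈ L, i ∈ F :=
      (Filter.eventually_all_finset _).2 fun i hi => (hlim i).1 hi
    have h2 : ∀ᶠ F : Finset ι in U, F ≠ L := hUc (Set.finite_singleton L).compl_mem_cofinite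
    filter_upwards [h1, h2] with F h1 h2
    exact Finset.card_lt_card (Finset.ssubset_iff_subset_ne.2 ⟨h1, h2.symm⟩)
  have hge : 1 ≤ cardWeight (L.card + 1) * |sumFunctional T L y| := by
    have ht : Tendsto (fun F => cardWeight (L.card + 1) * |sumFunctional T F y|) U
        (𝓝 (cardWeight (L.card + 1) * |sumFunctional T L y|)) :=
      ((h.tendsto_sumFunctional hU𝓕 hL hlim y).abs).const_mul _
    have hk : ∀ k : ℕ, 1 - 1 / ((k : ℝ) + 1) ≤ cardWeight (L.card + 1) * |sumFunctional T L y| := by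
      intro k
      refine ge_of_tendsto ht ?_
      filter_upwards [hUS k, hlt] with F h1 h2
      refine h1.2.le.trans (mul_le_mul_of_nonneg_right ?_ (abs_nonneg _))
      exact cardWeight_strictAnti.antitone h2
    have := (tendsto_const_nhds (x := (1 : ℝ))).sub tendsto_one_div_add_atTop_nhds_zero_nat
    rw [sub_zero] at this
    exact le_of_tendsto' this hk
  have hpos : 0 < |sumFunctional T L y| := by
    refine (abs_nonneg _).lt_of_ne' fun h0 => ?_
    rw [h0] at hge
    simp at hge
    linarith
  have := mul_lt_mul_of_pos_right (cardWeight_strictAnti (Nat.lt_succ_self L.card)) hpos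
  have := hy L hL
  linarith

/-- The weighted norm depends locally on finitely many of the functionals. -/
theorem exists_finite_locally {y : E} (hy : y ∈ weightedBall 𝓕 T) :
    ∃ δ > 0, ∃ Φ : Finset (Finset ι), ∀ u ∈ weightedBall 𝓕 T, ‖u - y‖ < δ → ∀ v, ‖v‖ < δ →
      (∀ F ∈ Φ, sumFunctional T F v = 0) → u + v ∈ weightedBall 𝓕 T := by
  obtain ⟨η, hη, hfin⟩ := h.finite_almost_norming hy
  -- For the other `F` the value at `u + v` differs from that at `y` by at most `η / 2`; with weight
  -- at most `2` this costs at most the available gap `η`.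
  refine ⟨η / 4, by positivity, hfin.toFinset, fun u hu huy v hv hΦ F hF => ?_⟩
  by_cases hFΦ : F ∈ hfin.toFinset
  · rw [map_add, hΦ F hFΦ, add_zero]
    exact hu F hF
  · have h1 : cardWeight F.card * |sumFunctional T F y| ≤ 1 - η := by
      by_contra! hc
      exact hFΦ (by simpa using ⟨hF, hc⟩)
    have h2 := h.abs_sumFunctional_le hF (u - y + v)
    have h3 := norm_add_le (u - y) v
    have h4 : |sumFunctional T F (u + v)| ≤ |sumFunctional T F y| + η / 2 := by
      have : u + v = y + (u - y + v) := by abel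
      rw [this, map_add]
      exact (abs_add_le _ _).trans (by linarith)
    have h5 := cardWeight_le_two F.card
    have h6 := one_le_cardWeight F.card
    nlinarith

/-- If the set were infinite, add multiples `t e_i` of its vectors successively inside the weighted
ball, each `t` at least half of the best possible. Since `f` is bounded on the ball, the `t` are
summable and the sums converge to some `y` in the ball. Near `y` a fixed multiple of a fresh `e_j`
can still be added, so the `t` cannot tend to `0`. -/
theorem finite_le_apply (f : StrongDual ℝ E) {ε : ℝ} (hε : 0 < ε) [CompleteSpace E] :
    {i | ε ≤ f (T (Finsupp.single i 1))}.Finite := by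
  classical
  by_contra hA
  set A := {i | ε ≤ f (T (Finsupp.single i 1))}
  obtain ⟨i₀, hi₀⟩ := (show A.Infinite from hA).nonempty
  have step : ∀ u : weightedBall 𝓕 T, ∃ u' : weightedBall 𝓕 T, ∃ i ∈ A, ∃ t : ℝ, 0 ≤ t ∧
      (u' : E) = u + t • T (Finsupp.single i 1) ∧
      ∀ s : ℝ, 0 ≤ s → ∀ j ∈ A, (u : E) + s • T (Finsupp.single j 1) ∈ weightedBall 𝓕 T →
        s ≤ 2 * t := by
    rintro ⟨u, hu⟩
    set S : Set ℝ := {s | 0 ≤ s ∧ ∃ j ∈ A, u + s • T (Finsupp.single j 1) ∈ weightedBall 𝓕 T}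
    have hbdd : BddAbove S := by
      refine ⟨2, ?_⟩
      rintro s ⟨hs, j, -, hj⟩
      have h1 := h.norm_le_one_of_mem_weightedBall hj
      have h2 := h.norm_le_one_of_mem_weightedBall hu
      have h3 := norm_sub_le (u + s • T (Finsupp.single j 1)) u
      rw [add_sub_cancel_left, norm_smul, h.norm_single, Real.norm_of_nonneg hs] at h3
      linarith
    have h0 : (0 : ℝ) ∈ S := ⟨le_rfl, i₀, hi₀, by simpa using hu⟩
    -- The supremum may be `0`; then `t = 0` is a valid choice.
    rcases (le_csSup hbdd h0).eq_or_lt with h1 | h1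
    · refine ⟨⟨u, hu⟩, i₀, hi₀, 0, le_rfl, by simp, fun s hs j hj hsj => ?_⟩
      have := le_csSup hbdd (show s ∈ S from ⟨hs, j, hj, hsj⟩)
      linarith
    · obtain ⟨t, ⟨ht, i, hi, hti⟩, htS⟩ := exists_lt_of_lt_csSup ⟨0, h0⟩ (half_lt_self h1)
      refine ⟨⟨_, hti⟩, i, hi, t, ht, rfl, fun s hs j hj hsj => ?_⟩
      have := le_csSup hbdd (show s ∈ S from ⟨hs, j, hj, hsj⟩)
      linarith
  choose next idx hidx t ht hnext hmax using step
  set u : ℕ → weightedBall 𝓕 T := fun m => next^[m] ⟨0, zero_mem_weightedBall⟩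
  have hu : ∀ m, (u (m + 1) : E) = u m + t (u m) • T (Finsupp.single (idx (u m)) 1) := fun m => by
    simp only [u, Function.iterate_succ_apply']
    exact hnext _
  have hdist : ∀ m, dist (u m : E) (u (m + 1)) = t (u m) := fun m => by
    rw [hu, dist_self_add_right, norm_smul, h.norm_single, Real.norm_of_nonneg (ht _), mul_one]
  have hsum : ∀ m, ε * ∑ k ∈ Finset.range m, t (u k) ≤ f (u m) := fun m => by
    induction m with
    | zero => simp [u]
    | succ m ih =>
      rw [Finset.sum_range_succ, hu, map_add, map_smul, smul_eq_mul, mul_add]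
      have h1 : ε ≤ f (T (Finsupp.single (idx (u m)) 1)) := hidx (u m)
      have := mul_le_mul_of_nonneg_left h1 (ht (u m))
      linarith
  have hsummable : Summable fun m => t (u m) := by
    refine summable_of_sum_range_le (c := ‖f‖ / ε) (fun m => ht _) fun m => ?_
    rw [le_div_iff₀' hε]
    refine (hsum m).trans ((le_abs_self _).trans ((f.le_opNorm _).trans ?_))
    exact mul_le_of_le_one_right (norm_nonneg _) (h.norm_le_one_of_mem_weightedBall (u m).2)
  have hcauchy : CauchySeq fun m => (u m : E) :=
    cauchySeq_of_summable_dist (by simpa only [hdist] using hsummable)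
  obtain ⟨y, hy⟩ := cauchySeq_tendsto_of_complete hcauchy
  have hyB : y ∈ weightedBall 𝓕 T :=
    isClosed_weightedBall.mem_of_tendsto hy (Eventually.of_forall fun m => (u m).2)
  obtain ⟨δ, hδ, Φ, hΦ⟩ := h.exists_finite_locally hyB
  obtain ⟨j, hj, hjΦ⟩ := (show A.Infinite from hA).exists_notMem_finset (Φ.biUnion id)
  have hj0 : ∀ F ∈ Φ, sumFunctional T F ((δ / 2) • T (Finsupp.single j 1)) = 0 := by
    intro F hF
    rw [map_smul, h.sumFunctional_apply, Finset.sum_congr rfl fun j _ => Finsupp.single_apply,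
      Finset.sum_ite_eq, if_neg, smul_zero]
    intro hjF
    exact hjΦ (Finset.mem_biUnion.2 ⟨F, hF, hjF⟩)
  have hnorm : ‖(δ / 2) • T (Finsupp.single j 1)‖ < δ := by
    rw [norm_smul, h.norm_single, Real.norm_of_nonneg (by positivity)]
    linarith
  have hclose := Metric.tendsto_nhds.1 hy δ hδ
  have hsmall := (hsummable.tendsto_atTop_zero).eventually (gt_mem_nhds (show 0 < δ / 8 by positivity))
  obtain ⟨m, h1, h2⟩ := (hclose.and hsmall).exists
  rw [dist_eq_norm] at h1
  -- Maximality gives `δ / 2 ≤ 2 t`, against `t < δ / 8`.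
  have := hmax (u m) (δ / 2) (by positivity) j hj (hΦ _ (u m).2 h1 _ hnorm hj0)
  linarith

theorem isWeaklyNull [CompleteSpace E] : IsWeaklyNull fun i => T (Finsupp.single i 1) := by
  intro f
  rw [Metric.tendsto_nhds]
  intro ε hε
  have h1 := (h.finite_le_apply f hε).compl_mem_cofinite
  have h2 := (h.finite_le_apply (-f) hε).compl_mem_cofinite
  filter_upwards [h1, h2] with i h1 h2
  simp only [Set.mem_compl_iff, Set.mem_ofPred_eq, not_le, _root_.neg_apply] at h1 h2
  rw [dist_zero_right, Real.norm_eq_abs, abs_lt]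
  constructor <;> linarith

end IsNormedBy

/-! ### Sequences equivalent to the unit vectors of `c₀`. -/

section C0Embedding

variable {E : Type*} [NormedAddCommGroup E] [NormedSpace ℝ E]

theorem norm_sum_le_of_forall_abs_le {z : ℕ → E}
    (hup : ∀ (N : ℕ) (b : ℕ → ℝ), (∀ k, |b k| ≤ 1) → ‖∑ k ∈ Finset.range N, b k • z k‖ ≤ 1)
    {r : ℝ} (hr : 0 < r) (N : ℕ) (b : ℕ → ℝ) (hb : ∀ k, |b k| ≤ r) :
    ‖∑ k ∈ Finset.range N, b k • z k‖ ≤ r := by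
  have h1 := hup N (fun k => b k / r) fun k => by
    rw [abs_div, abs_of_pos hr, div_le_one hr]
    exact hb k
  have h2 : ∑ k ∈ Finset.range N, b k • z k = r • ∑ k ∈ Finset.range N, (b k / r) • z k := by
    rw [Finset.smul_sum]
    refine Finset.sum_congr rfl fun k _ => ?_
    rw [smul_smul, mul_div_cancel₀ _ hr.ne']
  rw [h2, norm_smul, Real.norm_of_nonneg hr.le]
  exact mul_le_of_le_one_right hr.le h1

/-- A sequence which is equivalent to the unit vectors of `c₀` spans a copy of `c₀`. -/
theorem exists_c0_le_of_bounds [CompleteSpace E] (Y : Submodule ℝ E) (hY : IsClosed (Y : Set E))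
    {z : ℕ → E} (hzY : ∀ k, z k ∈ Y) {c : ℝ} (hc : 0 < c)
    (hup : ∀ (N : ℕ) (b : ℕ → ℝ), (∀ k, |b k| ≤ 1) → ‖∑ k ∈ Finset.range N, b k • z k‖ ≤ 1)
    (hlow : ∀ (N : ℕ) (b : ℕ → ℝ), ∀ k < N, c * |b k| ≤ ‖∑ k ∈ Finset.range N, b k • z k‖) :
    ∃ Z : Submodule ℝ E, Z ≤ Y ∧ Nonempty (ZeroAtInftyContinuousMap ℕ ℝ ≃L[ℝ] Z) := by
  have hnorm : ∀ (f : ZeroAtInftyContinuousMap ℕ ℝ) k, |f k| ≤ ‖f‖ := fun f k => by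
    rw [← ZeroAtInftyContinuousMap.norm_toBCF_eq_norm]
    exact f.toBCF.norm_coe_le_norm k
  have hlim : ∀ f : ZeroAtInftyContinuousMap ℕ ℝ, ∃ y,
      Tendsto (fun N => ∑ k ∈ Finset.range N, f k • z k) atTop (𝓝 y) := by
    intro f
    refine cauchySeq_tendsto_of_complete ?_
    rw [Metric.cauchySeq_iff']
    intro ε hε
    have hf : Tendsto f atTop (𝓝 0) := by
      have := f.zero_at_infty'
      rwa [cocompact_eq_cofinite, Nat.cofinite_eq_atTop] at this
    obtain ⟨M, hM⟩ := eventually_atTop.1 (Metric.tendsto_nhds.1 hf (ε / 2) (by positivity))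
    refine ⟨M, fun N hN => ?_⟩
    -- Zeroing the first `M` coefficients turns the bound on full sums into a bound on tails.
    have h1 := norm_sum_le_of_forall_abs_le hup (half_pos hε) N
      (fun k => if M ≤ k then f k else 0) fun k => by
        split_ifs with hk
        · simpa using (hM k hk).le
        · rw [abs_zero]
          positivity
    rw [dist_eq_norm, ← Finset.sum_range_add_sum_Ico _ hN, add_sub_cancel_left]
    rw [← Finset.sum_range_add_sum_Ico _ hN] at h1
    have h2 : ∑ k ∈ Finset.range M, (if M ≤ k then f k else 0) • z k = 0 :=
      Finset.sum_eq_zero fun k hk => by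
        rw [if_neg (not_le.2 (Finset.mem_range.1 hk)), zero_smul]
    have h3 : ∑ k ∈ Finset.Ico M N, (if M ≤ k then f k else 0) • z k =
        ∑ k ∈ Finset.Ico M N, f k • z k :=
      Finset.sum_congr rfl fun k hk => by rw [if_pos (Finset.mem_Ico.1 hk).1]
    rw [h2, h3, zero_add] at h1
    linarith
  choose S hS using hlim
  let S₀ : ZeroAtInftyContinuousMap ℕ ℝ →ₗ[ℝ] E :=
    { toFun := S
      map_add' := fun f g => tendsto_nhds_unique (hS (f + g)) (by
        simpa [add_smul, Finset.sum_add_distrib] using (hS f).add (hS g))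
      map_smul' := fun a f => tendsto_nhds_unique (hS (a • f)) (by
        simpa [smul_smul, Finset.smul_sum] using (hS f).const_smul a) }
  have hle : ∀ f, ‖S₀ f‖ ≤ 1 * ‖f‖ := fun f => by
    rw [one_mul]
    refine le_of_forall_pos_le_add fun ε hε => ?_
    refine le_of_tendsto' (hS f).norm fun N => ?_
    exact norm_sum_le_of_forall_abs_le hup (by positivity) N f fun k => by
      linarith [hnorm f k]
  have hge : ∀ f, ‖f‖ ≤ c⁻¹ * ‖S₀ f‖ := fun f => by
    rw [← ZeroAtInftyContinuousMap.norm_toBCF_eq_norm]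
    refine (BoundedContinuousFunction.norm_le (by positivity)).2 fun k => ?_
    rw [inv_mul_eq_div, le_div_iff₀' hc]
    exact ge_of_tendsto (hS f).norm
      ((eventually_gt_atTop k).mono fun N hN => hlow N f k hN)
  let S₁ : ZeroAtInftyContinuousMap ℕ ℝ →L[ℝ] E := S₀.mkContinuous 1 hle
  have hanti : AntilipschitzWith ⟨c⁻¹, by positivity⟩ S₁ :=
    AddMonoidHomClass.antilipschitz_of_bound _ hge
  refine ⟨LinearMap.range S₁.toLinearMap, ?_, ⟨S₁.equivRange hanti.injective
    (hanti.isClosed_range S₁.uniformContinuous)⟩⟩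
  rintro _ ⟨f, rfl⟩
  exact hY.mem_of_tendsto (hS f) (Eventually.of_forall fun N =>
    Y.sum_mem fun k _ => Y.smul_mem _ (hzY k))

end C0Embedding

/-! ### Copies of `c₀` from local dependence on finitely many functionals. -/

section Greedy

variable {E : Type*} [NormedAddCommGroup E] [NormedSpace ℝ E]

/-- Finitely many functionals almost norm a finite dimensional subspace. -/
theorem exists_finset_norming (V : Submodule ℝ E) [FiniteDimensional ℝ V] :
    ∃ Φ : Finset (StrongDual ℝ E), ∀ v ∈ V, ∀ w, (∀ f ∈ Φ, f w = 0) → ‖v‖ ≤ 2 * ‖v + w‖ := by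
  classical
  choose f hf1 hf2 using fun v : E => exists_dual_vector'' ℝ v
  have : ProperSpace V := FiniteDimensional.proper_real V
  -- The norming functional of a point within `1 / 2` of a unit vector is at least `1 / 2` there;
  -- this is the source of the factor `2`.
  obtain ⟨t, ht, htf, hcov⟩ := (isCompact_sphere (0 : V) 1).finite_cover_balls
    (show (0 : ℝ) < 1 / 2 by norm_num)
  refine ⟨htf.toFinset.image fun v => f v, fun v hv w hw => ?_⟩
  rcases eq_or_ne v 0 with rfl | hv0
  · simp
  have hvpos : 0 < ‖v‖ := norm_pos_iff.2 hv0
  set u : V := ‖v‖⁻¹ • ⟨v, hv⟩ with hu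
  have hunorm : u ∈ Metric.sphere (0 : V) 1 := by
    rw [mem_sphere_zero_iff_norm, hu, norm_smul]
    simp [hvpos.ne']
  obtain ⟨v₀, hv₀, hdist⟩ := Set.mem_iUnion₂.1 (hcov hunorm)
  have hw0 : f v₀ w = 0 := hw _ (Finset.mem_image.2 ⟨v₀, by simpa using hv₀, rfl⟩)
  have hv₀norm : ‖(v₀ : E)‖ = 1 := by simpa using ht hv₀
  have h1 : f v₀ v₀ = 1 := by rw [hf2, hv₀norm]; rfl
  have h2 : ‖(u : E) - v₀‖ < 1 / 2 := by
    rw [Metric.mem_ball, dist_eq_norm] at hdist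
    exact hdist
  have h3 : |f v₀ ((u : E) - v₀)| ≤ ‖(u : E) - v₀‖ :=
    ((f v₀).le_opNorm _).trans (mul_le_of_le_one_left (norm_nonneg _) (hf1 _))
  have h4 : 1 / 2 ≤ f v₀ u := by
    rw [map_sub, h1] at h3
    linarith [(abs_le.1 h3).1]
  have h5 : f v₀ u = ‖v‖⁻¹ * f v₀ v := by
    rw [hu]
    simp
  have h6 : f v₀ (v + w) ≤ ‖v + w‖ := (le_abs_self _).trans
    (((f v₀).le_opNorm _).trans (mul_le_of_le_one_left (norm_nonneg _) (hf1 _)))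
  rw [map_add, hw0, add_zero] at h6
  rw [h5, inv_mul_eq_div, le_div_iff₀ hvpos] at h4
  linarith

theorem exists_ne_zero_forall_apply_eq_zero {Y : Submodule ℝ E} (hY : ¬ FiniteDimensional ℝ Y)
    (Φ : Finset (StrongDual ℝ E)) : ∃ v ∈ Y, v ≠ 0 ∧ ∀ f ∈ Φ, f v = 0 := by
  by_contra! hc
  apply hY
  let A : Y →ₗ[ℝ] (Φ → ℝ) := LinearMap.pi fun f => f.1.toLinearMap.comp Y.subtype
  refine FiniteDimensional.of_injective A ((injective_iff_map_eq_zero A).2 fun v hv => ?_)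
  by_contra hv0
  obtain ⟨f, hf, hfv⟩ := hc v v.2 (by simpa using hv0)
  exact hfv (congrFun hv ⟨f, hf⟩)

/-- The set `B` depends locally on finitely many functionals. -/
def LocallyFiniteDetermined (B : Set E) : Prop :=
  ∀ y ∈ B, ∃ δ > 0, ∃ Φ : Finset (StrongDual ℝ E), ∀ u ∈ B, ‖u - y‖ < δ → ∀ v, ‖v‖ < δ →
    (∀ f ∈ Φ, f v = 0) → u + v ∈ B

/-- Compactness induction: two pieces combine by taking the smaller radius and the union of the
functionals. -/
theorem LocallyFiniteDetermined.exists_uniform {B : Set E} (hB : LocallyFiniteDetermined B)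
    {C : Set E} (hC : IsCompact C) (hCB : C ⊆ B) :
    ∃ δ > 0, ∃ Φ : Finset (StrongDual ℝ E), ∀ u ∈ C, ∀ v, ‖v‖ < δ →
      (∀ f ∈ Φ, f v = 0) → u + v ∈ B := by
  classical
  refine hC.induction_on (p := fun s => ∃ δ > 0, ∃ Φ : Finset (StrongDual ℝ E), ∀ u ∈ s, ∀ v,
    ‖v‖ < δ → (∀ f ∈ Φ, f v = 0) → u + v ∈ B) ⟨1, one_pos, ∅, by simp⟩ ?_ ?_ ?_
  · rintro s t hst ⟨δ, hδ, Φ, h⟩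
    exact ⟨δ, hδ, Φ, fun u hu => h u (hst hu)⟩
  · rintro s t ⟨δ, hδ, Φ, h⟩ ⟨δ', hδ', Φ', h'⟩
    refine ⟨min δ δ', lt_min hδ hδ', Φ ∪ Φ', fun u hu v hv hΦ => ?_⟩
    rcases hu with hu | hu
    · exact h u hu v (hv.trans_le (min_le_left _ _)) fun f hf => hΦ f (Finset.mem_union_left _ hf)
    · exact h' u hu v (hv.trans_le (min_le_right _ _)) fun f hf => hΦ f (Finset.mem_union_right _ hf)
  · intro y hy
    obtain ⟨δ, hδ, Φ, h⟩ := hB y (hCB hy)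
    refine ⟨C ∩ Metric.ball y δ, inter_mem_nhdsWithin _ (Metric.ball_mem_nhds y hδ), δ, hδ, Φ,
      fun u hu => h u (hCB hu.1) ?_⟩
    rw [← dist_eq_norm]
    exact hu.2

/-- A compact finite dimensional piece of `B`, and functionals which almost norm its span. -/
structure GreedyState (B : Set E) where
  carrier : Set E
  functionals : Finset (StrongDual ℝ E)
  isCompact : IsCompact carrier
  subset : carrier ⊆ B
  zero_mem : 0 ∈ carrier
  finiteDimensional : FiniteDimensional ℝ (Submodule.span ℝ carrier)
  norming : ∀ v ∈ Submodule.span ℝ carrier, ∀ w, (∀ f ∈ functionals, f w = 0) → ‖v‖ ≤ 2 * ‖v + w‖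

/-- The new vector has at least half the supremal norm among admissible ones, a supremum that is
finite because `B` is bounded. The functionals are enlarged so as to norm the new span, which keeps
the basis constant at `2`. -/
theorem GreedyState.exists_next {B : Set E} (hB1 : ∀ y ∈ B, ‖y‖ ≤ 1) (Y : Submodule ℝ E)
    (s : GreedyState B) : ∃ (s' : GreedyState B) (x : E), x ∈ Y ∧
      (∀ f ∈ s.functionals, f x = 0) ∧ s.functionals ⊆ s'.functionals ∧
      (∀ u, u ∈ s'.carrier ↔ ∃ u₀ ∈ s.carrier, ∃ t : ℝ, |t| ≤ 1 ∧ u = u₀ + t • x) ∧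
      ∀ x' ∈ Y, (∀ f ∈ s.functionals, f x' = 0) →
        (∀ u ∈ s.carrier, ∀ t : ℝ, |t| ≤ 1 → u + t • x' ∈ B) → ‖x'‖ ≤ 2 * ‖x‖ := by
  classical
  set S : Set E := {x | x ∈ Y ∧ (∀ f ∈ s.functionals, f x = 0) ∧
    ∀ u ∈ s.carrier, ∀ t : ℝ, |t| ≤ 1 → u + t • x ∈ B}
  have hS0 : (0 : E) ∈ S := ⟨Y.zero_mem, by simp, fun u hu t _ => by simpa using s.subset hu⟩
  have hbdd : BddAbove (norm '' S) := by
    refine ⟨1, ?_⟩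
    rintro _ ⟨x, hx, rfl⟩
    simpa using hB1 _ (hx.2.2 0 s.zero_mem 1 (by simp))
  obtain ⟨x, hxS, hx⟩ : ∃ x ∈ S, ∀ x' ∈ S, ‖x'‖ ≤ 2 * ‖x‖ := by
    have h0 : (0 : ℝ) ∈ norm '' S := ⟨0, hS0, norm_zero⟩
    rcases (le_csSup hbdd h0).eq_or_lt with h1 | h1
    · refine ⟨0, hS0, fun x' hx' => ?_⟩
      have := le_csSup hbdd ⟨x', hx', rfl⟩
      rw [← h1] at this
      simpa using this
    · obtain ⟨_, ⟨x, hx, rfl⟩, h2⟩ := exists_lt_of_lt_csSup ⟨0, h0⟩ (half_lt_self h1)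
      refine ⟨x, hx, fun x' hx' => ?_⟩
      have := le_csSup hbdd ⟨x', hx', rfl⟩
      linarith
  set K : Set E := (fun a : E × ℝ => a.1 + a.2 • x) '' (s.carrier ×ˢ Set.Icc (-1) 1) with hK
  have hmem : ∀ u, u ∈ K ↔ ∃ u₀ ∈ s.carrier, ∃ t : ℝ, |t| ≤ 1 ∧ u = u₀ + t • x := by
    intro u
    constructor
    · rintro ⟨⟨u₀, t⟩, ⟨h1, h2⟩, rfl⟩
      exact ⟨u₀, h1, t, abs_le.2 h2, rfl⟩
    · rintro ⟨u₀, h1, t, h2, rfl⟩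
      exact ⟨(u₀, t), ⟨h1, abs_le.1 h2⟩, rfl⟩
  have hfin : FiniteDimensional ℝ (Submodule.span ℝ K) := by
    have := s.finiteDimensional
    refine Submodule.finiteDimensional_of_le
      (S₂ := Submodule.span ℝ s.carrier ⊔ Submodule.span ℝ {x}) (Submodule.span_le.2 fun u hu => ?_)
    obtain ⟨u₀, hu₀, t, -, rfl⟩ := (hmem u).1 hu
    exact Submodule.add_mem_sup (Submodule.subset_span hu₀)
      (Submodule.smul_mem _ _ (Submodule.mem_span_singleton_self x))
  obtain ⟨Φ, hΦ⟩ := exists_finset_norming (Submodule.span ℝ K)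
  refine ⟨⟨K, s.functionals ∪ Φ, ?_, ?_, ?_, hfin, fun v hv w hw => hΦ v hv w fun f hf =>
    hw f (Finset.mem_union_right _ hf)⟩, x, hxS.1, hxS.2.1, Finset.subset_union_left, hmem,
    fun x' h1 h2 h3 => hx x' ⟨h1, h2, h3⟩⟩
  · exact (s.isCompact.prod isCompact_Icc).image (by fun_prop)
  · intro u hu
    obtain ⟨u₀, hu₀, t, ht, rfl⟩ := (hmem u).1 hu
    exact hxS.2.2 u₀ hu₀ t ht
  · exact (hmem 0).2 ⟨0, s.zero_mem, 0, by simp, by simp⟩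

/-- An infinite dimensional closed subspace contains `c₀` if the space has a bounded closed set that
contains `0` and depends locally on finitely many functionals. -/
theorem LocallyFiniteDetermined.exists_c0_le [CompleteSpace E] {B : Set E}
    (hB : LocallyFiniteDetermined B) (hBc : IsClosed B) (hB0 : 0 ∈ B) (hB1 : ∀ y ∈ B, ‖y‖ ≤ 1)
    (Y : Submodule ℝ E) (hY : IsClosed (Y : Set E)) (hYinf : ¬ FiniteDimensional ℝ Y) :
    ∃ Z : Submodule ℝ E, Z ≤ Y ∧ Nonempty (ZeroAtInftyContinuousMap ℕ ℝ ≃L[ℝ] Z) := by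
  classical
  choose next vec hvecY hvecΦ hΦ hcarrier hmax using GreedyState.exists_next hB1 Y
  let s₀ : GreedyState B :=
    { carrier := {0}
      functionals := ∅
      isCompact := isCompact_singleton
      subset := by simpa using hB0
      zero_mem := rfl
      finiteDimensional := by rw [Submodule.span_zero_singleton]; infer_instance
      norming := fun v hv w _ => by
        rw [Submodule.span_zero_singleton, Submodule.mem_bot] at hv
        simp [hv] }
  let s : ℕ → GreedyState B := fun m => next^[m] s₀
  have hs : ∀ m, s (m + 1) = next (s m) := fun m => Function.iterate_succ_apply' _ _ _
  let K : ℕ → Set E := fun m => (s m).carrier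
  let x : ℕ → E := fun m => vec (s m)
  have hK : ∀ m u, u ∈ K (m + 1) ↔ ∃ u₀ ∈ K m, ∃ t : ℝ, |t| ≤ 1 ∧ u = u₀ + t • x m := fun m u => by
    simp only [K, hs, x]
    exact hcarrier _ _
  have hΦmono : Monotone fun m => (s m).functionals := monotone_nat_of_le_succ fun m => by
    rw [hs]
    exact hΦ _
  have hKmono : Monotone K := monotone_nat_of_le_succ fun m u hu =>
    (hK m u).2 ⟨u, hu, 0, by simp, by simp⟩
  have hxΦ : ∀ m i, m ≤ i → ∀ f ∈ (s m).functionals, f (x i) = 0 := fun m i hmi f hf =>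
    hvecΦ (s i) f (hΦmono hmi hf)
  let Tail : ℕ → ℕ → Set E := fun m m' =>
    {w | ∃ a : ℕ → ℝ, (∀ i, |a i| ≤ 1) ∧ w = ∑ i ∈ Finset.Ico m m', a i • x i}
  have hadd : ∀ m m', m ≤ m' → ∀ w ∈ Tail m m', ∀ u ∈ K m, ∀ t : ℝ, |t| ≤ 1 →
      u + t • w ∈ K m' := by
    rintro m m' hm _ ⟨a, ha, rfl⟩ u hu t ht
    induction m', hm using Nat.le_induction with
    | base => simpa using hu
    | succ m' hm ih =>
      refine (hK _ _).2 ⟨_, ih, t * a m', ?_, ?_⟩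
      · rw [abs_mul]
        exact mul_le_one₀ ht (abs_nonneg _) (ha _)
      · rw [Finset.sum_Ico_succ_top hm, smul_add, smul_smul, add_assoc]
  have hsplit : ∀ m m', m ≤ m' → ∀ u ∈ K m', ∃ u₀ ∈ K m, ∃ w ∈ Tail m m', u = u₀ + w := by
    intro m m' hm
    induction m', hm using Nat.le_induction with
    | base => exact fun u hu => ⟨u, hu, 0, ⟨0, by simp, by simp⟩, by simp⟩
    | succ m' hm ih =>
      intro u hu
      obtain ⟨u₁, hu₁, t, ht, rfl⟩ := (hK _ _).1 hu
      obtain ⟨u₀, hu₀, _, ⟨a, ha, rfl⟩, rfl⟩ := ih u₁ hu₁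
      refine ⟨u₀, hu₀, _, ⟨Function.update a m' t, fun i => ?_, rfl⟩, ?_⟩
      · rcases eq_or_ne i m' with rfl | hi
        · simpa using ht
        · simpa [hi] using ha i
      · rw [Finset.sum_Ico_succ_top hm, Function.update_self, ← add_assoc]
        congr 2
        refine Finset.sum_congr rfl fun i hi => ?_
        rw [Function.update_of_ne (Finset.mem_Ico.1 hi).2.ne]
  -- Either blocks with coefficients in `[-1, 1]` and norm at least `ε` occur arbitrarily far out,
  -- and they span `c₀`, or all such tails are uniformly small.
  by_cases hcase : ∃ ε > 0, ∀ m, ∃ m' ≥ m, ∃ w ∈ Tail m m', ε ≤ ‖w‖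
  · obtain ⟨ε, hε, hblock⟩ := hcase
    choose nx hnx w hw hwε using hblock
    have hwY : ∀ m, w m ∈ Y := fun m => by
      obtain ⟨a, -, h⟩ := hw m
      rw [h]
      exact Y.sum_mem fun i _ => Y.smul_mem _ (hvecY _)
    have hwΦ : ∀ m i, m ≤ i → ∀ f ∈ (s m).functionals, f (w i) = 0 := fun m i hmi f hf => by
      obtain ⟨a, -, h⟩ := hw i
      rw [h, map_sum]
      refine Finset.sum_eq_zero fun j hj => ?_
      rw [map_smul, hxΦ m j (hmi.trans (Finset.mem_Ico.1 hj).1) f hf, smul_zero]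
    let M : ℕ → ℕ := fun k => nx^[k] 0
    have hM : ∀ k, M (k + 1) = nx (M k) := fun k => Function.iterate_succ_apply' _ _ _
    have hMmono : Monotone M := monotone_nat_of_le_succ fun k => by
      rw [hM]
      exact hnx _
    let z : ℕ → E := fun k => w (M k)
    have hmem : ∀ (N : ℕ) (b : ℕ → ℝ), (∀ k, |b k| ≤ 1) →
        ∑ k ∈ Finset.range N, b k • z k ∈ K (M N) := by
      intro N b hb
      induction N with
      | zero => simpa using (s (M 0)).zero_mem
      | succ N ih =>
        rw [Finset.sum_range_succ, hM]
        exact hadd _ _ (hnx _) _ (hw _) _ ih _ (hb N)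
    have hzK : ∀ k, z k ∈ K (M (k + 1)) := fun k => by
      rw [hM]
      simpa using hadd _ _ (hnx (M k)) _ (hw _) 0 (s (M k)).zero_mem 1 (by simp)
    have hbasic : ∀ (N N' : ℕ) (b : ℕ → ℝ), N ≤ N' →
        ‖∑ k ∈ Finset.range N, b k • z k‖ ≤ 2 * ‖∑ k ∈ Finset.range N', b k • z k‖ := by
      intro N N' b hN
      rw [← Finset.sum_range_add_sum_Ico _ hN]
      refine (s (M N)).norming _ ?_ _ fun f hf => ?_
      · refine Submodule.sum_mem _ fun k hk => Submodule.smul_mem _ _ (Submodule.subset_span ?_)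
        exact hKmono (hMmono (Finset.mem_range.1 hk)) (hzK k)
      · rw [map_sum]
        refine Finset.sum_eq_zero fun k hk => ?_
        rw [map_smul, hwΦ _ _ (hMmono (Finset.mem_Ico.1 hk).1) f hf, smul_zero]
    -- The upper bound holds because the sums stay in `B`; the lower one because `b k • z k` is a
    -- difference of two partial sums, each at most twice the full sum.
    refine exists_c0_le_of_bounds Y hY (z := z) (fun k => hwY _) (c := ε / 4) (by positivity)
      (fun N b hb => hB1 _ ((s (M N)).subset (hmem N b hb))) fun N b k hk => ?_
    have h1 := hbasic k N b hk.le
    have h2 := hbasic (k + 1) N b hk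
    have h3 : b k • z k = ∑ k ∈ Finset.range (k + 1), b k • z k - ∑ k ∈ Finset.range k, b k • z k := by
      rw [Finset.sum_range_succ, add_sub_cancel_left]
    have h4 : ε * |b k| ≤ ‖b k • z k‖ := by
      rw [norm_smul, Real.norm_eq_abs, mul_comm]
      exact mul_le_mul_of_nonneg_left (hwε _) (abs_nonneg _)
    have h5 := norm_sub_le (∑ k ∈ Finset.range (k + 1), b k • z k) (∑ k ∈ Finset.range k, b k • z k)
    rw [← h3] at h5
    linarith
  · push Not at hcase
    exfalso
    -- Small tails put every `K m` near one compact `K m₀`, so the closure of the union is compact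
    -- in `B` and has a uniform radius `δ`.
    have htb : TotallyBounded (⋃ m, K m) := by
      rw [Metric.totallyBounded_iff]
      intro ε hε
      obtain ⟨m₀, hm₀⟩ := hcase (ε / 2) (by positivity)
      obtain ⟨t, -, htf, ht⟩ := (s m₀).isCompact.finite_cover_balls (half_pos hε)
      refine ⟨t, htf, fun u hu => ?_⟩
      obtain ⟨m, hm⟩ := Set.mem_iUnion.1 hu
      obtain ⟨u₀, hu₀, w, hw, rfl⟩ := hsplit m₀ (max m m₀) (le_max_right _ _) u
        (hKmono (le_max_left _ _) hm)
      obtain ⟨y, hy, hdist⟩ := Set.mem_iUnion₂.1 (ht hu₀)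
      refine Set.mem_iUnion₂.2 ⟨y, hy, ?_⟩
      have h1 := hm₀ _ (le_max_right _ _) w hw
      rw [Metric.mem_ball] at hdist ⊢
      have h2 := dist_triangle (u₀ + w) u₀ y
      rw [dist_self_add_left] at h2
      linarith
    have hsub : closure (⋃ m, K m) ⊆ B :=
      closure_minimal (Set.iUnion_subset fun m => (s m).subset) hBc
    obtain ⟨δ, hδ, Φ, hΦ'⟩ := hB.exists_uniform
      (htb.closure.isCompact_of_isClosed isClosed_closure) hsub
    obtain ⟨m, hm⟩ := hcase (δ / 4) (by positivity)
    -- Scaled to norm `δ / 2`, `v` was admissible at stage `m`, so `δ / 2 ≤ 2 ‖x m‖`, while the tail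
    -- bound gives `‖x m‖ < δ / 4`.
    obtain ⟨v, hvY, hv0, hvΦ⟩ := exists_ne_zero_forall_apply_eq_zero hYinf (Φ ∪ (s m).functionals)
    have hvpos : 0 < ‖v‖ := norm_pos_iff.2 hv0
    have hnorm : ‖(δ / 2 * ‖v‖⁻¹) • v‖ = δ / 2 := by
      rw [norm_smul, Real.norm_of_nonneg (by positivity), mul_assoc, inv_mul_cancel₀ hvpos.ne',
        mul_one]
    have h1 := hmax (s m) ((δ / 2 * ‖v‖⁻¹) • v) (Y.smul_mem _ hvY)
      (fun f hf => by rw [map_smul, hvΦ f (Finset.mem_union_right _ hf), smul_zero])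
      fun u hu t ht => hΦ' u (subset_closure (Set.mem_iUnion.2 ⟨m, hu⟩)) _ (by
        rw [norm_smul, hnorm, Real.norm_eq_abs]
        nlinarith) fun f hf => by
        rw [map_smul, map_smul, hvΦ f (Finset.mem_union_left _ hf), smul_zero, smul_zero]
    have h2 := hm (m + 1) (Nat.le_succ m) (x m) ⟨fun _ => 1, by simp, by simp⟩
    rw [hnorm] at h1
    change ‖vec (s m)‖ < _ at h2
    linarith

end Greedy

/-! ### Coordinate projections, unconditionality and the spreading model norm. -/

open scoped Classical in
/-- The restriction of a finitely supported function to `A`. -/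
def restrictFinsupp {ι : Type*} (A : Set ι) : (ι →₀ ℝ) →ₗ[ℝ] (ι →₀ ℝ) :=
  Submodule.subtype _ ∘ₗ Finsupp.restrictDom ℝ ℝ A

theorem restrictFinsupp_apply {ι : Type*} (A : Set ι) [DecidablePred (· ∈ A)] (x : ι →₀ ℝ)
    (i : ι) : restrictFinsupp A x i = if i ∈ A then x i else 0 := by
  classical
  simp [restrictFinsupp, Finsupp.filter_apply]

/-- The projection which restricts the coordinates to `A`. -/
def coordProjection {ι E : Type*} [NormedAddCommGroup E] [NormedSpace ℝ E] [CompleteSpace E]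
    (T : (ι →₀ ℝ) →ₗ[ℝ] E) (A : Set ι) : E →L[ℝ] E :=
  (T ∘ₗ restrictFinsupp A).extendOfNorm T

/-- The seminorm `max (∑ a_i⁺) (∑ a_i⁻)` on `c₀₀(ℕ)`. -/
def signSumSeminorm : Seminorm ℝ (ℕ →₀ ℝ) :=
  Seminorm.of (fun a => (|a.sum fun _ t => t| + a.sum fun _ t => |t|) / 2)
    (fun a b => by
      classical
      have h1 : (a + b).sum (fun _ t => t) = (a.sum fun _ t => t) + b.sum fun _ t => t :=
        Finsupp.sum_add_index' (fun _ => rfl) fun _ _ _ => rfl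
      have h2 : (a + b).sum (fun _ t => |t|) ≤ (a.sum fun _ t => |t|) + b.sum fun _ t => |t| := by
        have hs : ∀ c : ℕ →₀ ℝ, c.support ⊆ a.support ∪ b.support →
            (c.sum fun _ t => |t|) = ∑ i ∈ a.support ∪ b.support, |c i| := fun c hc =>
          Finsupp.sum_of_support_subset _ hc _ fun _ _ => abs_zero
        rw [hs _ Finsupp.support_add, hs _ Finset.subset_union_left, hs _ Finset.subset_union_right,
          ← Finset.sum_add_distrib]
        exact Finset.sum_le_sum fun i _ => abs_add_le _ _
      rw [h1]
      have := abs_add_le (a.sum fun _ t => t) (b.sum fun _ t => t)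
      linarith)
    fun r a => by
      have h1 : (r • a).sum (fun _ t => t) = r * a.sum fun _ t => t := by
        rw [Finsupp.sum_smul_index fun _ => rfl, Finsupp.mul_sum]
      have h2 : (r • a).sum (fun _ t => |t|) = |r| * a.sum fun _ t => |t| := by
        rw [Finsupp.sum_smul_index fun _ => abs_zero, Finsupp.mul_sum]
        simp only [abs_mul]
      rw [h1, h2, abs_mul, Real.norm_eq_abs]
      ring

theorem signSumSeminorm_apply (a : ℕ →₀ ℝ) :
    signSumSeminorm a = (|a.sum fun _ t => t| + a.sum fun _ t => |t|) / 2 := rfl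

theorem isEquivToL1_signSumSeminorm : IsEquivToL1 signSumSeminorm := by
  refine ⟨1 / 2, 1, by norm_num, fun a => ?_⟩
  rw [signSumSeminorm_apply]
  have h1 : |a.sum fun _ t => t| ≤ a.sum fun _ t => |t| := Finset.abs_sum_le_sum_abs _ _
  have h2 := abs_nonneg (a.sum fun _ t => t)
  constructor <;> linarith

namespace IsNormedBy

variable {ι E : Type*} [NormedAddCommGroup E] [NormedSpace ℝ E]
  {𝓕 : Set (Finset ι)} {T : (ι →₀ ℝ) →ₗ[ℝ] E} (h : IsNormedBy 𝓕 T)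
include h

theorem isC0Saturated [CompleteSpace E] : IsC0Saturated E := by
  classical
  intro Y hY hYinf
  refine LocallyFiniteDetermined.exists_c0_le (B := weightedBall 𝓕 T) (fun y hy => ?_)
    isClosed_weightedBall zero_mem_weightedBall (fun y => h.norm_le_one_of_mem_weightedBall) Y hY
    hYinf
  obtain ⟨δ, hδ, Φ, hΦ⟩ := h.exists_finite_locally hy
  exact ⟨δ, hδ, Φ.image (sumFunctional T), fun u hu huy v hv hvΦ =>
    hΦ u hu huy v hv fun F hF => hvΦ _ (Finset.mem_image_of_mem _ hF)⟩

/-- Testing the restriction against `F` is testing `x` against `F ∩ A`, again in the family. -/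
theorem norm_restrict_le (A : Set ι) (x : ι →₀ ℝ) :
    ‖T (restrictFinsupp A x)‖ ≤ ‖T x‖ := by
  classical
  refine h.norm_le _ _ fun F hF => ?_
  rw [Finset.sum_congr rfl fun i _ => restrictFinsupp_apply A x i,
    ← Finset.sum_filter]
  exact h.abs_sum_le x _ (h.hereditary F hF _ (Finset.filter_subset _ _))

section Complete

variable [CompleteSpace E]

theorem coordProjection_apply (A : Set ι) (x : ι →₀ ℝ) :
    coordProjection T A (T x) = T (restrictFinsupp A x) :=
  LinearMap.extendOfNorm_eq h.dense ⟨1, fun x => by simpa using h.norm_restrict_le A x⟩ x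

theorem norm_coordProjection_le (A : Set ι) (y : E) : ‖coordProjection T A y‖ ≤ ‖y‖ := by
  have := LinearMap.norm_extendOfNorm_apply_le (𝕜 := ℝ) (𝕜₂ := ℝ) (σ₁₂ := RingHom.id ℝ)
    (f := T ∘ₗ restrictFinsupp A) h.dense 1
    (fun x => by simpa using h.norm_restrict_le A x) y
  simpa [coordProjection] using this

theorem coordProjection_single (A : Set ι) [DecidablePred (· ∈ A)] (i : ι) :
    coordProjection T A (T (Finsupp.single i 1)) =
      if i ∈ A then T (Finsupp.single i 1) else 0 := by
  classical
  rw [h.coordProjection_apply]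
  have : restrictFinsupp A (Finsupp.single i 1) = if i ∈ A then Finsupp.single i 1 else 0 := by
    ext j
    rw [restrictFinsupp_apply]
    rcases eq_or_ne i j with rfl | hij
    · split_ifs <;> simp
    · split_ifs <;> simp [hij.symm]
  rw [this, apply_ite T, map_zero]

omit [CompleteSpace E] in
/-- Continuous linear maps that agree on the vectors `e_i` are equal. -/
theorem ext_single {G : Type*} [NormedAddCommGroup G] [NormedSpace ℝ G] {f g : E →L[ℝ] G}
    (hfg : ∀ i, f (T (Finsupp.single i 1)) = g (T (Finsupp.single i 1))) : f = g := by
  ext y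
  refine h.dense.induction (P := fun y => f y = g y) ?_ (isClosed_eq f.continuous g.continuous) y
  rintro _ ⟨x, rfl⟩
  have : f.toLinearMap ∘ₗ T = g.toLinearMap ∘ₗ T := by
    ext i
    exact hfg i
  exact LinearMap.congr_fun this x

omit [CompleteSpace E] in
theorem coordFunctional_single [DecidableEq ι] (i j : ι) :
    coordFunctional T i (T (Finsupp.single j 1)) = if j = i then 1 else 0 := by
  rw [h.coordFunctional_apply, Finsupp.single_apply]

theorem sum_coordFunctional_smul (F : Finset ι) (y : E) :
    ∑ i ∈ F, coordFunctional T i y • T (Finsupp.single i 1) =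
      coordProjection T (F : Set ι) y := by
  classical
  have : ∑ i ∈ F, (coordFunctional T i).smulRight (T (Finsupp.single i 1)) =
      coordProjection T (F : Set ι) := by
    refine h.ext_single fun j => ?_
    simp [_root_.sum_apply, h.coordFunctional_single, h.coordProjection_single]
  rw [← this]
  simp [_root_.sum_apply]

/-- If the sets `A b` eventually agree on every finite set with `A₀`, then the projections
converge. -/
theorem tendsto_coordProjection {β : Type*} {l : Filter β} {A : β → Set ι} {A₀ : Set ι}
    (hA : ∀ i, ∀ᶠ b in l, i ∈ A b ↔ i ∈ A₀) (y : E) :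
    Tendsto (fun b => coordProjection T (A b) y) l (𝓝 (coordProjection T A₀ y)) := by
  classical
  rw [Metric.tendsto_nhds]
  intro ε hε
  obtain ⟨_, ⟨x, rfl⟩, hx⟩ := Metric.mem_closure_iff.1 (h.dense y) (ε / 2) (by positivity)
  rw [dist_eq_norm] at hx
  filter_upwards [(Filter.eventually_all_finset x.support).2 fun i _ => hA i] with b hb
  have heq : coordProjection T (A b) (T x) = coordProjection T A₀ (T x) := by
    rw [h.coordProjection_apply, h.coordProjection_apply]
    congr 1
    ext i
    rw [restrictFinsupp_apply, restrictFinsupp_apply]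
    by_cases hi : i ∈ x.support
    · simp only [hb i hi]
    · rw [Finsupp.notMem_support_iff.1 hi, ite_self, ite_self]
  have h1 := h.norm_coordProjection_le (A b) (y - T x)
  have h2 := h.norm_coordProjection_le A₀ (y - T x)
  rw [map_sub] at h1 h2
  rw [heq] at h1
  rw [norm_sub_rev] at h2
  rw [dist_eq_norm]
  have h3 := norm_sub_le_norm_sub_add_norm_sub (coordProjection T (A b) y)
    (coordProjection T A₀ (T x)) (coordProjection T A₀ y)
  linarith

theorem coordProjection_univ (y : E) : coordProjection T Set.univ y = y := by
  classical
  have : coordProjection T Set.univ = ContinuousLinearMap.id ℝ E :=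
    h.ext_single fun i => by simp [h.coordProjection_single]
  rw [this]
  rfl

theorem coordProjection_empty (y : E) : coordProjection T ∅ y = 0 := by
  simpa using (h.sum_coordFunctional_smul ∅ y).symm

theorem exists_unconditionalSchauderBasis :
    ∃ b : UnconditionalSchauderBasis ι ℝ E, ⇑b = fun i => T (Finsupp.single i 1) := by
  classical
  refine ⟨⟨fun i => T (Finsupp.single i 1), coordFunctional T, fun i j => ?_, fun x => ?_⟩, rfl⟩
  · rw [h.coordFunctional_single, Pi.single_apply]
    simp only [eq_comm]
  · have := h.tendsto_coordProjection (l := atTop) (A := fun F : Finset ι => (F : Set ι))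
      (A₀ := Set.univ) (fun i => (eventually_ge_atTop {i}).mono fun F hF => by
        simpa using Finset.singleton_subset_iff.1 hF) x
    rw [h.coordProjection_univ] at this
    simp only [HasSum, SummationFilter.unconditional_filter, h.sum_coordFunctional_smul]
    exact this

theorem isSuppressionUnconditional :
    IsSuppressionUnconditional fun i => T (Finsupp.single i 1) := by
  classical
  intro F G hGF a
  have : ∑ i ∈ G, a i • T (Finsupp.single i 1) =
      coordProjection T (G : Set ι) (∑ i ∈ F, a i • T (Finsupp.single i 1)) := by
    rw [map_sum]
    simp only [map_smul, h.coordProjection_single, Finset.mem_coe, smul_ite, smul_zero]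
    rw [← Finset.sum_filter, Finset.filter_mem_eq_inter, Finset.inter_eq_right.2 hGF]
  rw [this]
  exact h.norm_coordProjection_le _ _

end Complete

/-- Any `F` picks out a partial sum `P` of the coefficients; with `N` the sum of the rest, `2 |P| ≤
|P + N| + |P| + |N|`, which gives the upper bound. Equality is attained at the indices with
nonnegative or with negative coefficients, since both sets belong to the family. -/
theorem norm_eq_signSumSeminorm {g : ℕ → ι} (hg : Function.Injective g) (a : ℕ →₀ ℝ)
    (ha : ∀ I ⊆ a.support, I.map ⟨g, hg⟩ ∈ 𝓕) :
    ‖a.sum fun i c => c • T (Finsupp.single (g i) 1)‖ = signSumSeminorm a := by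
  classical
  have hev : ∀ F : Finset ι, sumFunctional T F (a.sum fun i c => c • T (Finsupp.single (g i) 1)) =
      ∑ i ∈ a.support with g i ∈ F, a i := by
    intro F
    rw [Finsupp.sum, map_sum, Finset.sum_filter]
    refine Finset.sum_congr rfl fun i _ => ?_
    rw [map_smul, h.sumFunctional_apply, Finset.sum_congr rfl fun j _ => Finsupp.single_apply,
      Finset.sum_ite_eq, smul_eq_mul, mul_ite, mul_one, mul_zero]
  have hsplit : ∀ (p : ℕ → Prop) [DecidablePred p] (f : ℕ → ℝ),
      ∑ i ∈ a.support, f i = ∑ i ∈ a.support with p i, f i + ∑ i ∈ a.support with ¬ p i, f i :=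
    fun p _ f => (Finset.sum_filter_add_sum_filter_not _ _ _).symm
  rw [signSumSeminorm_apply]
  simp only [Finsupp.sum]
  refine le_antisymm (h.norm_le_of_forall fun F _ => ?_) ?_
  · have hF := hev F
    rw [Finsupp.sum] at hF
    rw [hF, hsplit (fun i => g i ∈ F) a, hsplit (fun i => g i ∈ F) fun i => |a i|]
    set P := ∑ i ∈ a.support with g i ∈ F, a i
    set N := ∑ i ∈ a.support with ¬ g i ∈ F, a i
    have h1 : |P| ≤ ∑ i ∈ a.support with g i ∈ F, |a i| := Finset.abs_sum_le_sum_abs _ _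
    have h2 : |N| ≤ ∑ i ∈ a.support with ¬ g i ∈ F, |a i| := Finset.abs_sum_le_sum_abs _ _
    have h3 : |P| ≤ |P + N| + |N| := by
      simpa using abs_sub (P + N) N
    linarith
  · set x := ∑ i ∈ a.support, a i • T (Finsupp.single (g i) 1) with hx
    rw [hsplit (fun i => 0 ≤ a i) a, hsplit (fun i => 0 ≤ a i) fun i => |a i|]
    have h1 : ∑ i ∈ a.support with 0 ≤ a i, |a i| = ∑ i ∈ a.support with 0 ≤ a i, a i :=
      Finset.sum_congr rfl fun i hi => abs_of_nonneg (Finset.mem_filter.1 hi).2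
    have h2 : ∑ i ∈ a.support with ¬ 0 ≤ a i, |a i| = - ∑ i ∈ a.support with ¬ 0 ≤ a i, a i := by
      rw [← Finset.sum_neg_distrib]
      exact Finset.sum_congr rfl fun i hi => abs_of_neg (not_le.1 (Finset.mem_filter.1 hi).2)
    have hle : ∀ (p : ℕ → Prop) [DecidablePred p], |∑ i ∈ a.support with p i, a i| ≤ ‖x‖ := by
      intro p _
      have h3 := h.abs_sumFunctional_le (ha _ (Finset.filter_subset p _)) x
      have h4 := hev ((a.support.filter p).map ⟨g, hg⟩)
      rw [Finsupp.sum, ← hx] at h4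
      rw [h4] at h3
      convert h3 using 3
      ext i
      simp only [Finset.mem_filter, Finset.mem_map, Function.Embedding.coeFn_mk]
      constructor
      · rintro ⟨h5, h6⟩
        exact ⟨h5, i, ⟨h5, h6⟩, rfl⟩
      · rintro ⟨h5, j, ⟨-, h6⟩, h7⟩
        exact ⟨h5, hg h7 ▸ h6⟩
    have h3 := abs_le.1 (hle fun i => 0 ≤ a i)
    have h4 := abs_le.1 (hle fun i => ¬ 0 ≤ a i)
    rw [h1, h2]
    rcases abs_cases (∑ i ∈ a.support with 0 ≤ a i, a i + ∑ i ∈ a.support with ¬ 0 ≤ a i, a i)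
      with ⟨h5, -⟩ | ⟨h5, -⟩ <;> rw [h5] <;> linarith

end IsNormedBy

/-! ### The transfinite basis. -/

theorem IsNormedBy.isTransfiniteBasis {E : Type*} [NormedAddCommGroup E] [NormedSpace ℝ E]
    [CompleteSpace E] {𝓕 : Set (Finset ContIndex)} {T : (ContIndex →₀ ℝ) →ₗ[ℝ] E}
    (h : IsNormedBy 𝓕 T) : IsTransfiniteBasis fun η => T (Finsupp.single η 1) := by
  classical
  intro x
  refine ⟨fun η => coordFunctional T η x,
    ⟨fun η => coordProjection T {ζ | ζ.1 < η} x, ?_, fun η => ?_, fun η _ _ => ?_, ?_⟩, ?_⟩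
  · have : {ζ : ContIndex | ζ.1 < 0} = ∅ := by
      ext ζ
      simp
    simp only [this, h.coordProjection_empty]
  · have : coordProjection T {ζ | ζ.1 < Order.succ η.1} = coordProjection T {ζ | ζ.1 < η.1} +
        (coordFunctional T η).smulRight (T (Finsupp.single η 1)) := by
      refine h.ext_single fun j => ?_
      simp only [_root_.add_apply, ContinuousLinearMap.smulRight_apply, h.coordProjection_single,
        h.coordFunctional_single, Set.mem_ofPred_eq, Order.lt_succ_iff]
      rcases lt_trichotomy j η with hj | rfl | hj
      · have h1 : j.1 < η.1 := hj
        simp [h1, h1.le, hj.ne]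
      · simp
      · have h1 : η.1 < j.1 := hj
        simp [h1.not_ge, h1.le.not_gt, hj.ne']
    simp only [this]
    rfl
  · refine h.tendsto_coordProjection (fun ζ => ?_) x
    by_cases hζ : ζ.1 < η
    · filter_upwards [mem_nhdsWithin_of_mem_nhds (Ioi_mem_nhds hζ)] with b hb
      exact iff_of_true hb hζ
    · filter_upwards [self_mem_nhdsWithin] with b hb
      exact iff_of_false (fun hc => hζ (lt_trans hc hb)) hζ
  · have : {ζ : ContIndex | ζ.1 < (Cardinal.continuum.{0}).ord} = Set.univ :=
      Set.eq_univ_of_forall fun ζ => ζ.2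
    simp only [this, h.coordProjection_univ]
  · rintro a ⟨s, hs0, hsucc, hlim, hsx⟩
    funext ζ
    -- Uniqueness: in any expansion the `ζ`-th coordinate of the partial sums jumps from `0` to `a
    -- ζ` right after `ζ` and stays constant, at limit ordinals by continuity.
    have key : ∀ η ≤ (Cardinal.continuum.{0}).ord,
        coordFunctional T ζ (s η) = if ζ.1 < η then a ζ else 0 := by
      intro η
      induction η using Ordinal.limitRecOn with
      | zero =>
        intro _
        simp [hs0]
      | add_one η ih =>
        intro hη
        have hη' : η < (Cardinal.continuum.{0}).ord := (Order.lt_succ η).trans_le hη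
        have h1 := hsucc ⟨η, hη'⟩
        change s (η + 1) = s η + a ⟨η, hη'⟩ • T (Finsupp.single ⟨η, hη'⟩ 1) at h1
        rw [h1, map_add, ih hη'.le, map_smul, h.coordFunctional_single]
        rcases lt_trichotomy ζ.1 η with hj | hj | hj
        · have h2 : (⟨η, hη'⟩ : ContIndex) ≠ ζ := fun hc => hj.ne (congrArg Subtype.val hc).symm
          simp [hj, hj.le, h2]
        · have h2 : (⟨η, hη'⟩ : ContIndex) = ζ := Subtype.ext hj.symm
          simp [h2, hj]
        · have h2 : (⟨η, hη'⟩ : ContIndex) ≠ ζ := fun hc => hj.ne (congrArg Subtype.val hc)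
          simp [hj.not_ge, hj.le.not_gt, h2]
      | limit η hη ih =>
        intro hηc
        have hne : (𝓝[<] η).NeBot :=
          hη.isSuccPrelimit.isLUB_Iio.nhdsWithin_neBot ⟨0, bot_lt_iff_ne_bot.2 hη.ne_bot⟩
        refine tendsto_nhds_unique
          (((coordFunctional T ζ).continuous.tendsto _).comp (hlim η hηc hη))
          (tendsto_const_nhds.congr' ?_)
        by_cases hζ : ζ.1 < η
        · filter_upwards [mem_nhdsWithin_of_mem_nhds (Ioi_mem_nhds hζ), self_mem_nhdsWithin]
            with b hb hbη
          rw [Function.comp_apply, ih b hbη (le_trans (le_of_lt hbη) hηc), if_pos hζ,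
            if_pos (show ζ.1 < b from hb)]
        · filter_upwards [self_mem_nhdsWithin] with b hbη
          rw [Function.comp_apply, ih b hbη (le_trans (le_of_lt hbη) hηc), if_neg hζ,
            if_neg fun hc => hζ (lt_trans hc hbη)]
    have := key _ le_rfl
    rw [hsx, if_pos (show ζ.1 < _ from ζ.2)] at this
    exact this.symm

/-! ### Branching subsequences and the spaces `X_n`. -/

/-- Every sequence of distinct points of the Cantor set has a subsequence which branches off a limit
point at strictly increasing levels. -/
theorem exists_branching_subseq {τ : ℕ → CantorSet} (hτ : Function.Injective τ) :
    ∃ φ : ℕ → ℕ, StrictMono φ ∧ ∃ σ, (∀ j, σ ≠ τ (φ j)) ∧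
      StrictMono fun j => meetLen σ (τ (φ j)) := by
  obtain ⟨σ, φ, hφ, hlim⟩ := CompactSpace.tendsto_subseq τ
  -- By injectivity at most one term equals the limit.
  have hne : ∀ᶠ j in atTop, σ ≠ τ (φ j) := by
    have : {j | σ = τ (φ j)}.Subsingleton := fun i hi j hj =>
      hφ.injective (hτ (hi.symm.trans hj))
    have := this.finite.compl_mem_cofinite
    rwa [Nat.cofinite_eq_atTop] at this
  have hcyl : ∀ N, ∀ᶠ j in atTop, τ (φ j) ∈ PiNat.cylinder σ N := fun N =>
    hlim ((PiNat.isOpen_cylinder _ σ N).mem_nhds (PiNat.self_mem_cylinder σ N))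
  obtain ⟨M, hM⟩ := eventually_atTop.1 hne
  have htend : Tendsto (fun j => meetLen σ (τ (φ (j + M)))) atTop atTop := by
    rw [tendsto_atTop]
    intro N
    filter_upwards [(tendsto_add_atTop_nat M).eventually (hcyl N)] with j hj
    have hj' := hM (j + M) (Nat.le_add_left _ _)
    rw [meetLen, PiNat.firstDiff_comm]
    exact (PiNat.mem_cylinder_iff_le_firstDiff hj'.symm N).1 hj
  obtain ⟨ψ, hψ, hmono⟩ := strictMono_subseq_of_tendsto_atTop htend
  exact ⟨fun j => φ (ψ j + M), fun i j hij => hφ (Nat.add_lt_add_right (hψ hij) M), σ,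
    fun j => hM _ (Nat.le_add_left _ _), hmono⟩

theorem GFam.map_mem_one {σ : CantorSet} {τ : ℕ → CantorSet} (hne : ∀ j, σ ≠ τ j)
    (hmono : StrictMono fun j => meetLen σ (τ j)) (hτ : Function.Injective τ) (I : Finset ℕ)
    (hI : ∀ i ∈ I, I.card ≤ meetLen σ (τ i)) : I.map ⟨τ, hτ⟩ ∈ GFam 1 := by
  rcases I.eq_empty_or_nonempty with rfl | hIne
  · exact GFam.empty_mem 1
  obtain ⟨k, hk⟩ := Nat.exists_eq_succ_of_ne_zero (Finset.card_pos.2 hIne).ne'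
  have hcard := hI _ (I.orderEmbOfFin_mem hk 0)
  rw [hk] at hcard
  refine Or.inr ⟨σ, _, _, GPair.base k (fun j => τ (I.orderEmbOfFin hk j)) _ σ ?_ (fun j => hne _)
    (by omega) (fun i j hij => hmono ((I.orderEmbOfFin hk).strictMono hij)) hcard⟩
  have := I.range_orderEmbOfFin hk
  rw [Finset.coe_map, ← this, ← Set.range_comp]
  rfl

section

variable (n : ℕ) [NeZero n] (ξ : CantorSet ≃ ContIndex)

/-- The embedding of the finitely supported functions into `X_n`. -/
def finsuppToXSpace : (ContIndex →₀ ℝ) →ₗ[ℝ] XSpace n ξ :=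
  (UniformSpace.Completion.toComplₗᵢ (𝕜 := ℝ) (E := C00 n ξ)).toLinearMap

theorem norm_finsuppToXSpace (x : ContIndex →₀ ℝ) : ‖finsuppToXSpace n ξ x‖ = supNorm n ξ x :=
  UniformSpace.Completion.norm_coe (E := C00 n ξ) x

/-- The family `𝒢_n`, transported to the ordinals below `𝔠`. -/
def indexFam : Set (Finset ContIndex) := {F | F.map ξ.symm.toEmbedding ∈ GFam n}

omit [NeZero n] in
theorem evalSet_map (F : Finset ContIndex) (x : ContIndex →₀ ℝ) :
    evalSet n ξ (F.map ξ.symm.toEmbedding) x = ∑ i ∈ F, x i := by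
  rw [evalSet_apply, Finset.sum_map]
  simp

theorem isNormedBy : IsNormedBy (indexFam n ξ) (finsuppToXSpace n ξ) where
  dense := UniformSpace.Completion.denseRange_coe (α := C00 n ξ)
  abs_sum_le x F hF := by
    rw [norm_finsuppToXSpace, ← evalSet_map n ξ]
    exact abs_evalSet_le n ξ x hF
  norm_le x r hr := by
    rw [norm_finsuppToXSpace]
    refine ciSup_le fun F => ?_
    have hF : (F.1.map ξ.toEmbedding).map ξ.symm.toEmbedding = F.1 := by
      ext τ
      simp
    have := hr (F.1.map ξ.toEmbedding) (by
      change _ ∈ GFam n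
      rw [hF]
      exact F.2)
    rwa [← evalSet_map n ξ, hF] at this
  empty_mem := GFam.empty_mem n
  singleton_mem i := by
    change Finset.map _ _ ∈ GFam n
    rw [Finset.map_singleton]
    exact GFam.singleton_mem n _
  hereditary F hF G hG := GFam.hereditary hF (Finset.map_subset_map.2 hG)
  limit U hU := by
    obtain ⟨L, hL, hlim⟩ := GFam.exists_ultrafilter_limit n U
      (fun F => F.map ξ.symm.toEmbedding) hU
    refine ⟨L.map ξ.toEmbedding, ?_, fun i => ?_⟩
    · have hF : (L.map ξ.toEmbedding).map ξ.symm.toEmbedding = L := by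
        ext τ
        simp
      change _ ∈ GFam n
      rwa [hF]
    · have := hlim (ξ.symm i)
      simpa using this

/-- Strictly increasing levels satisfy `j ≤ |σ ∧ τ_j|`. Once `m 0` is at least the size of the
support of `a`, every subset of the support is mapped into `𝒢_1`, and the norm is not merely close
to its limit but equal to it. -/
theorem exists_subseq_norm_eq {k : ℕ → ContIndex} (hk : Function.Injective k) :
    ∃ φ : ℕ → ℕ, StrictMono φ ∧ ∀ a : ℕ →₀ ℝ, ∃ N, ∀ m : ℕ → ℕ, StrictMono m → N ≤ m 0 →
      ‖a.sum fun i c => c • unitVec n ξ (k (φ (m i)))‖ = signSumSeminorm a := by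
  obtain ⟨φ, hφ, σ, hne, hmono⟩ := exists_branching_subseq (ξ.symm.injective.comp hk)
  refine ⟨φ, hφ, fun a => ⟨a.support.card, fun m hm hN => ?_⟩⟩
  have hg : Function.Injective fun i => k (φ (m i)) := hk.comp (hφ.injective.comp hm.injective)
  refine (isNormedBy n ξ).norm_eq_signSumSeminorm hg a fun I hI => ?_
  refine GFam.mono_one (NeZero.ne n) ?_
  rw [Finset.map_map]
  refine GFam.map_mem_one (σ := σ) (τ := fun i => ξ.symm (k (φ (m i)))) (fun j => hne _)
    (fun i j hij => hmono (hm hij)) (ξ.symm.injective.comp hg) I fun i _ => ?_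
  calc I.card ≤ a.support.card := Finset.card_le_card hI
    _ ≤ m 0 := hN
    _ ≤ m i := hm.monotone (Nat.zero_le i)
    _ ≤ _ := hmono.le_apply

theorem admitsOnlyL1 {k : ℕ → ContIndex} (hk : Function.Injective k) :
    AdmitsOnlyL1 fun j => unitVec n ξ (k j) := by
  constructor
  · obtain ⟨φ, hφ, h⟩ := exists_subseq_norm_eq n ξ hk
    refine ⟨signSumSeminorm, φ, hφ, fun a ε hε => ?_⟩
    obtain ⟨N, hN⟩ := h a
    refine ⟨N, fun m hm hm0 => ?_⟩
    simp only [Function.comp_apply, hN m hm hm0, sub_self, abs_zero]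
    exact hε
  · rintro p ⟨ψ, hψ, hp⟩
    -- A subsequence generating `p` has a further subsequence along which the norms equal
    -- `signSumSeminorm`; both must give the same limit.
    have hpeq : p = signSumSeminorm := by
      obtain ⟨φ, hφ, h⟩ := exists_subseq_norm_eq n ξ (hk.comp hψ.injective)
      ext a
      refine eq_of_forall_dist_le fun ε hε => ?_
      obtain ⟨N, hN⟩ := h a
      obtain ⟨N', hN'⟩ := hp a ε hε
      have hm : StrictMono fun i => i + max N N' := fun i j hij => Nat.add_lt_add_right hij _
      have h1 := hN _ hm (by simp)
      have h2 := hN' _ (hφ.comp hm) ((le_max_right N N').trans (by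
        simpa using hφ.le_apply (x := max N N')))
      simp only [Function.comp_apply] at h1 h2
      rw [h1, abs_sub_comm] at h2
      rw [Real.dist_eq]
      exact h2.le
    rw [hpeq]
    exact isEquivToL1_signSumSeminorm

end

end

theorem mainTheorem7 (n : ℕ) [NeZero n] (ξ : CantorSet ≃ ContIndex) :
    IsC0Saturated (XSpace n ξ) ∧
    ((∀ η, ‖unitVec n ξ η‖ = 1) ∧
      IsTransfiniteBasis (unitVec n ξ) ∧
      (∃ b : UnconditionalSchauderBasis ContIndex ℝ (XSpace n ξ), ⇑b = unitVec n ξ) ∧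
      IsSuppressionUnconditional (unitVec n ξ) ∧
      IsWeaklyNull (unitVec n ξ)) ∧
    ∀ k : ℕ → ContIndex, Function.Injective k →
      AdmitsOnlyL1 fun j => unitVec n ξ (k j) := by
  have h := isNormedBy n ξ
  exact ⟨h.isC0Saturated, ⟨h.norm_single, h.isTransfiniteBasis,
    h.exists_unconditionalSchauderBasis, h.isSuppressionUnconditional, h.isWeaklyNull⟩,
    fun _ => admitsOnlyL1 n ξ⟩
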